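/- For an integer $m\ge 0$ let $\mathrm{pod}(m)$ denote the number of partitions of $m$ in which no odd part is repeated (so $\mathrm{pod}(0)=1$), and put $\mathrm{pod}(m)=0$ for $m<0$. For integers $k,n\ge 1$ let $$MP_k(n)=(-1)^{k-1}\sum_{j=0}^{k-1}(-1)^j\Big(\mathrm{pod}\big(n-j(2j+1)\big)-\mathrm{pod}\big(n-(j+1)(2j+1)\big)\Big).$$ **Theorem.** Let $\varepsilon>0$. Then, as $n\to\infty$, for $k\ll n^{\frac18-\varepsilon}$, $$MP_k(n)=\frac{\pi}{16}\,k\,n^{-\frac32}e^{\frac{\pi\sqrt n}{\sqrt2}}+O\!\left(k^3n^{-\frac74}e^{\frac{\pi\sqrt n}{\sqrt2}}\right),$$ uniformly in $k$ and with an absolute implied constant. That is, there is an absolute constant $C>0$ such that for all $\varepsilon>0$ and $A>0$ there is an $N$ such that for all integers $n\ge N$ and all integers $k$ with $1\le k\le A\,n^{\frac18-\varepsilon}$, $$\left|MP_k(n)-\frac{\pi}{16}\,k\,n^{-\frac32}e^{\frac{\pi\sqrt n}{\sqrt2}}\right|\le C\,k^3n^{-\frac74}e^{\frac{\pi\sqrt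 n}{\sqrt2}}.$$ -/

import Mathlib

/-- `pod m` is the number of partitions of the integer `m` in which no odd part is repeated
(even parts may be repeated freely); it is `0` for negative `m`, and `pod 0 = 1`. -/
def pod : ℤ → ℕ
  | Int.ofNat m =>
      ((Finset.univ : Finset (Nat.Partition m)).filter
        (fun p => ∀ i ∈ p.parts, Odd i → p.parts.count i = 1)).card
  | Int.negSucc _ => 0

/-- The truncated pod-function `MP_k(n)`, for `k, n ≥ 1`. -/
def MP (k n : ℕ) : ℤ :=
  (-1) ^ (k - 1) * ∑ j ∈ Finset.range k, (-1) ^ j *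
    ((pod ((n : ℤ) - (j : ℤ) * (2 * (j : ℤ) + 1)) : ℤ) -
      (pod ((n : ℤ) - ((j : ℤ) + 1) * (2 * (j : ℤ) + 1)) : ℤ))

/-!
The proof is the circle method applied to the generating function `F(q) = ∑ pod(n) q^n`, for which
`MP k n` is the coefficient of `q^n` in `F(q) P_k(q)`, where
`P_k(q) = (-1)^{k-1} ∑_{j<k} (-1)^j (q^{j(2j+1)} - q^{(j+1)(2j+1)})`.

Two descriptions of `F` are used. The product `F(q) = ∏ (1 + q^{2i+1}) / (1 - q^{2i+2})`
(`tendsto_podProd`) shows that `F` is exponentially smaller off the positive real axis than on it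
(`norm_podGenFun_minor_le`). Gauss' identity `F(q) ∑_{m ∈ ℤ} (-1)^m q^{2m²+m} = 1`
(`podGenFun_mul_theta`), obtained as the limit of a telescoping finite identity of Shanks
(`shanks_identity`), together with the functional equation of the Jacobi theta function gives
`F(e^{-t}) = √(t/π) e^{π²/(8t)} (1 + O(t))` in the cone `|im t| ≤ re t`
(`exists_podGenFun_approx`).

Cauchy's formula is applied on the line `re t = a` with `a = π / √(8n)`, the saddle point of
`π²/(8t) + nt`. On the major arc `|im t| ≤ a` the alternating sum `∑_{j<k} (-1)^j (2j+1)`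
collapses to `±k`, so that `P_k(e^{-t}) = k t + O(k⁵ t²)` (`norm_truncTheta_sub_le`). The remaining
integral of `k t^{3/2} e^{π²/(8t) + nt}` is evaluated by comparison with a Gaussian
(`norm_integral_saddle_sub_le`), at the cost of a relative error `n^{-1/4}`. The error from `P_k` is
`k⁵ n^{-2}`, which is at most `k³ n^{-7/4}` exactly when `k ≤ n^{1/8}`; this is where the range of
`k` enters, and since it holds for all large `n` the constant does not depend on `ε` and `A`.
-/

open Filter Topology MeasureTheory
open scoped PowerSeries.WithPiTopology

/-! ### The generating function as an infinite product -/

/-- The weight of `c` copies of the part `i`: no odd part may occur more than once. -/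
noncomputable def podWeight (i c : ℕ) : ℝ := if Odd i ∧ c ≠ 1 then 0 else 1

theorem coeff_genFun_podWeight (n : ℕ) :
    (Nat.Partition.genFun podWeight).coeff n = (pod n : ℝ) := by
  rw [Nat.Partition.coeff_genFun]
  have h : ∀ p : n.Partition, p.parts.toFinsupp.prod podWeight =
      if ∀ i ∈ p.parts, Odd i → p.parts.count i = 1 then (1 : ℝ) else 0 := by
    intro p
    rw [Finsupp.prod, Multiset.toFinsupp_support]
    split_ifs with hp
    · refine Finset.prod_eq_one fun i hi => ?_
      have := hp i (Multiset.mem_toFinset.1 hi)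
      have h2 : ¬ (Odd i ∧ p.parts.toFinsupp i ≠ 1) := by
        rw [Multiset.toFinsupp_apply]; tauto
      exact if_neg h2
    · push Not at hp
      obtain ⟨i, hi, ho, hc⟩ := hp
      refine Finset.prod_eq_zero (Multiset.mem_toFinset.2 hi) ?_
      simp [podWeight, ho, hc]
  simp_rw [h]
  rw [Finset.sum_boole]
  rfl

/-- The factor `∑_c w(i + 1, c) X^{(i+1) c}` of the generating function belonging to the part
`i + 1`; the index is shifted because parts are positive. -/
noncomputable def podFactor (i : ℕ) : PowerSeries ℝ :=
  1 + ∑' j, podWeight (i + 1) (j + 1) • PowerSeries.X ^ ((i + 1) * (j + 1))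

theorem coeff_podFactor (i n : ℕ) : (podFactor i).coeff n =
    if i + 1 ∣ n then (if n / (i + 1) = 0 then 1 else podWeight (i + 1) (n / (i + 1))) else 0 := by
  rw [podFactor, map_add, (Nat.Partition.summable_genFun_term podWeight i).map_tsum _
    (PowerSeries.WithPiTopology.continuous_coeff _ _)]
  simp only [map_smul, PowerSeries.coeff_X_pow, PowerSeries.coeff_one, smul_eq_mul, mul_ite,
    mul_one, mul_zero]
  rcases Nat.eq_zero_or_pos n with rfl | hn
  · simp
  rw [if_neg hn.ne', zero_add]
  by_cases h1 : i + 1 ∣ n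
  · obtain ⟨c, rfl⟩ := h1
    have hc : 0 < c := Nat.pos_of_mul_pos_left hn
    obtain ⟨d, rfl⟩ : ∃ d, c = d + 1 := ⟨c - 1, by omega⟩
    rw [tsum_eq_single d, if_pos rfl, if_pos (dvd_mul_right _ _),
      Nat.mul_div_cancel_left _ (Nat.succ_pos i), if_neg (Nat.succ_ne_zero d)]
    · intro b hb
      rw [if_neg]
      intro h
      exact hb (by have := Nat.eq_of_mul_eq_mul_left (Nat.succ_pos i) h; omega)
  · rw [if_neg h1]
    convert tsum_zero with b
    rw [if_neg]
    rintro rfl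
    exact h1 (dvd_mul_right _ _)

theorem podWeight_nonneg (i c : ℕ) : 0 ≤ podWeight i c := by
  unfold podWeight; split_ifs <;> norm_num

theorem coeff_podFactor_nonneg (i n : ℕ) : 0 ≤ (podFactor i).coeff n := by
  rw [coeff_podFactor]
  split_ifs <;> first | exact zero_le_one | exact podWeight_nonneg _ _ | exact le_rfl

theorem coeff_zero_podFactor (i : ℕ) : (podFactor i).coeff 0 = 1 := by
  simp [coeff_podFactor]

/-- The factor of the part `i + 1` may be summed over the number of copies of that part. -/
theorem hasSum_podFactor (i : ℕ) {q v : ℂ}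
    (h : HasSum (fun c : ℕ => ((if c = 0 then 1 else podWeight (i + 1) c : ℝ) : ℂ) *
      q ^ ((i + 1) * c)) v) :
    HasSum (fun n : ℕ => ((podFactor i).coeff n : ℂ) * q ^ n) v := by
  have hinj : Function.Injective (fun c : ℕ => (i + 1) * c) :=
    fun a b hab => Nat.eq_of_mul_eq_mul_left (Nat.succ_pos i) hab
  rw [← hinj.hasSum_iff]
  · convert h using 2 with c
    rw [Function.comp_apply, coeff_podFactor, if_pos (dvd_mul_right _ _),
      Nat.mul_div_cancel_left _ (Nat.succ_pos i)]
  · intro n hn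
    rw [coeff_podFactor, if_neg]
    · simp
    · rintro ⟨c, rfl⟩
      exact hn ⟨c, rfl⟩

theorem hasSum_podFactor_even_index (i : ℕ) (q : ℂ) :
    HasSum (fun n : ℕ => ((podFactor (2 * i)).coeff n : ℂ) * q ^ n) (1 + q ^ (2 * i + 1)) := by
  apply hasSum_podFactor
  have := hasSum_sum_of_ne_finset_zero (L := .unconditional ℕ) (s := Finset.range 2)
    (f := fun c : ℕ => ((if c = 0 then 1 else podWeight (2 * i + 1) c : ℝ) : ℂ) *
      q ^ ((2 * i + 1) * c)) (by
    intro b hb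
    have hb : ¬ b < 2 := by rwa [Finset.mem_range] at hb
    have h1 : b ≠ 0 := by omega
    have h2 : b ≠ 1 := by omega
    simp [podWeight, h1, h2])
  convert this using 1
  simp [Finset.sum_range_succ, podWeight]

theorem hasSum_podFactor_odd_index (i : ℕ) {q : ℂ} (hq : ‖q‖ < 1) :
    HasSum (fun n : ℕ => ((podFactor (2 * i + 1)).coeff n : ℂ) * q ^ n)
      (1 - q ^ (2 * i + 2))⁻¹ := by
  apply hasSum_podFactor
  have h1 : ‖q ^ (2 * i + 2)‖ < 1 := by
    rw [norm_pow]; exact pow_lt_one₀ (norm_nonneg _) hq (by omega)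
  refine (hasSum_geometric_of_norm_lt_one h1).congr_fun fun c => ?_
  have : ¬ Odd (2 * i + 1 + 1) := by
    rw [Nat.not_odd_iff_even]; exact ⟨i + 1, by ring⟩
  simp [podWeight, this, pow_mul]

/-- The partial products `∏_{i < N} (1 + q^{2i+1}) / (1 - q^{2i+2})` of the generating function. -/
noncomputable def podProd (N : ℕ) (q : ℂ) : ℂ :=
  ∏ i ∈ Finset.range N, (1 + q ^ (2 * i + 1)) / (1 - q ^ (2 * i + 2))

/-- The formal product of the first `N` factors. Since even and odd parts alternate, `podProd N`
corresponds to `podSeries (2 * N)`. -/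
noncomputable def podSeries (N : ℕ) : PowerSeries ℝ := ∏ i ∈ Finset.range N, podFactor i

theorem coeff_podSeries_nonneg (N n : ℕ) : 0 ≤ (podSeries N).coeff n := by
  induction N generalizing n with
  | zero => simp only [podSeries, Finset.range_zero, Finset.prod_empty, PowerSeries.coeff_one]
            split_ifs <;> norm_num
  | succ N ih =>
    rw [podSeries, Finset.prod_range_succ, PowerSeries.coeff_mul]
    exact Finset.sum_nonneg fun x _ => mul_nonneg (ih _) (coeff_podFactor_nonneg _ _)

theorem coeff_podSeries_mono (n : ℕ) : Monotone fun N => (podSeries N).coeff n := by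
  refine monotone_nat_of_le_succ fun N => ?_
  rw [podSeries, podSeries, Finset.prod_range_succ, PowerSeries.coeff_mul]
  have h := Finset.single_le_sum (s := Finset.HasAntidiagonal.antidiagonal n)
    (f := fun x => (∏ i ∈ Finset.range N, podFactor i).coeff x.1 * (podFactor N).coeff x.2)
    (fun x _ => mul_nonneg (coeff_podSeries_nonneg N _) (coeff_podFactor_nonneg _ _))
    (a := (n, 0)) (by simp)
  simpa [coeff_zero_podFactor] using h

theorem tendsto_coeff_podSeries (n : ℕ) :
    Tendsto (fun N => (podSeries N).coeff n) atTop (𝓝 (pod n : ℝ)) := by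
  have h := (Nat.Partition.hasProd_genFun podWeight).tendsto_prod_nat
  rw [PowerSeries.WithPiTopology.tendsto_iff_coeff_tendsto] at h
  have := h n
  rwa [coeff_genFun_podWeight] at this

theorem coeff_podSeries_le (N n : ℕ) : (podSeries N).coeff n ≤ pod n :=
  (coeff_podSeries_mono n).ge_of_tendsto (tendsto_coeff_podSeries n) N

theorem hasSum_mul_powerSeries {G H : PowerSeries ℝ} {q u v : ℂ}
    (hG : HasSum (fun n : ℕ => (G.coeff n : ℂ) * q ^ n) u)
    (hH : HasSum (fun n : ℕ => (H.coeff n : ℂ) * q ^ n) v) :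
    HasSum (fun n : ℕ => ((G * H).coeff n : ℂ) * q ^ n) (u * v) := by
  have h1 := hG.summable.norm
  have h2 := hH.summable.norm
  have key : ∀ n, ((G * H).coeff n : ℂ) * q ^ n = ∑ kl ∈ Finset.HasAntidiagonal.antidiagonal n,
      ((G.coeff kl.1 : ℂ) * q ^ kl.1) * ((H.coeff kl.2 : ℂ) * q ^ kl.2) := by
    intro n
    rw [PowerSeries.coeff_mul]
    push_cast
    rw [Finset.sum_mul]
    refine Finset.sum_congr rfl fun x hx => ?_
    rw [← Finset.HasAntidiagonal.mem_antidiagonal.1 hx, pow_add]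
    ring
  simp_rw [key]
  have hs := summable_norm_sum_mul_antidiagonal_of_summable_norm h1 h2
  have ht := tsum_mul_tsum_eq_tsum_sum_antidiagonal_of_summable_norm h1 h2
  rw [hG.tsum_eq, hH.tsum_eq] at ht
  rw [ht]
  exact hs.of_norm.hasSum

theorem hasSum_podSeries (N : ℕ) {q : ℂ} (hq : ‖q‖ < 1) :
    HasSum (fun n : ℕ => ((podSeries (2 * N)).coeff n : ℂ) * q ^ n) (podProd N q) := by
  induction N with
  | zero =>
    have := hasSum_single (f := fun n : ℕ => ((podSeries (2 * 0)).coeff n : ℂ) * q ^ n) 0 (by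
      intro b hb
      simp [podSeries, PowerSeries.coeff_one, hb])
    convert this using 1
    simp [podSeries, podProd]
  | succ N ih =>
    have h : podSeries (2 * (N + 1)) = podSeries (2 * N) * podFactor (2 * N) *
        podFactor (2 * N + 1) := by
      simp only [podSeries]
      rw [show 2 * (N + 1) = 2 * N + 1 + 1 by ring, Finset.prod_range_succ, Finset.prod_range_succ]
    rw [h, podProd, Finset.prod_range_succ, div_eq_mul_inv, ← mul_assoc]
    exact hasSum_mul_powerSeries (hasSum_mul_powerSeries ih (hasSum_podFactor_even_index N q))
      (hasSum_podFactor_odd_index N hq)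

/-- Products with factors `(1 + r^{a i}) / (1 - r^{b i})` are bounded, by comparison with
`∑ r^i`. -/
theorem prod_div_le_exp {r : ℝ} (h0 : 0 ≤ r) (h1 : r < 1) {a b : ℕ → ℕ} (ha : ∀ i, i < a i)
    (hb : ∀ i, i < b i) (N : ℕ) :
    ∏ i ∈ Finset.range N, (1 + r ^ a i) / (1 - r ^ b i) ≤ Real.exp (2 / (1 - r) ^ 2) := by
  have h3 : 0 < 1 - r := by linarith
  have hf : ∀ i ∈ Finset.range N, (1 + r ^ a i) / (1 - r ^ b i) ≤
      Real.exp (2 / (1 - r) * r ^ i) := by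
    intro i _
    have e1 : r ^ a i ≤ r ^ i := pow_le_pow_of_le_one h0 h1.le (ha i).le
    have e2 : r ^ b i ≤ r ^ i := pow_le_pow_of_le_one h0 h1.le (hb i).le
    have e3 : r ^ b i ≤ r := by
      simpa using pow_le_pow_of_le_one h0 h1.le (show 1 ≤ b i from by have := hb i; omega)
    have e4 : 0 < 1 - r ^ b i := by linarith
    have hp : 0 ≤ r ^ i := pow_nonneg h0 i
    rw [div_le_iff₀ e4]
    have e5 : 1 ≤ Real.exp (r ^ i / (1 - r)) * (1 - r ^ b i) := by
      have h6 : (1 - r ^ b i)⁻¹ ≤ Real.exp (r ^ i / (1 - r)) := by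
        refine le_trans ?_ (Real.add_one_le_exp _)
        rw [inv_le_iff_one_le_mul₀ e4, div_add_one h3.ne', div_mul_eq_mul_div, le_div_iff₀ h3]
        nlinarith [mul_nonneg hp (sub_nonneg.2 e3)]
      rwa [inv_le_iff_one_le_mul₀ e4] at h6
    have e6 : 1 + r ^ a i ≤ Real.exp (r ^ i / (1 - r)) := by
      refine le_trans ?_ (Real.add_one_le_exp _)
      have : r ^ i ≤ r ^ i / (1 - r) := by
        rw [le_div_iff₀ h3]; nlinarith
      linarith
    calc 1 + r ^ a i ≤ Real.exp (r ^ i / (1 - r)) * 1 := by linarith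
      _ ≤ Real.exp (r ^ i / (1 - r)) * (Real.exp (r ^ i / (1 - r)) * (1 - r ^ b i)) := by gcongr
      _ = Real.exp (2 / (1 - r) * r ^ i) * (1 - r ^ b i) := by
        rw [← mul_assoc, ← Real.exp_add]; congr 2; ring
  have hnn : ∀ i ∈ Finset.range N, 0 ≤ (1 + r ^ a i) / (1 - r ^ b i) := by
    intro i _
    have e3 : r ^ b i ≤ 1 := pow_le_one₀ h0 h1.le
    have : 0 ≤ 1 - r ^ b i := by linarith
    positivity
  refine (Finset.prod_le_prod hnn hf).trans ?_
  rw [← Real.exp_sum, ← Finset.mul_sum]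
  apply Real.exp_le_exp.2
  have : ∑ i ∈ Finset.range N, r ^ i ≤ 1 / (1 - r) := by
    rw [one_div, ← tsum_geometric_of_lt_one h0 h1]
    exact (summable_geometric_of_lt_one h0 h1).sum_le_tsum _ (fun i _ => pow_nonneg h0 i)
  calc 2 / (1 - r) * ∑ i ∈ Finset.range N, r ^ i ≤ 2 / (1 - r) * (1 / (1 - r)) := by gcongr
    _ = 2 / (1 - r) ^ 2 := by field_simp

/-- The partial sums are dominated by the partial products, which are bounded. -/
theorem summable_pod_mul_pow {r : ℝ} (h0 : 0 ≤ r) (h1 : r < 1) :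
    Summable fun n : ℕ => (pod n : ℝ) * r ^ n := by
  refine summable_of_sum_range_le (c := Real.exp (2 / (1 - r) ^ 2))
    (fun n => by positivity) fun M => ?_
  have ht : Tendsto (fun N => ∑ n ∈ Finset.range M, (podSeries N).coeff n * r ^ n) atTop
      (𝓝 (∑ n ∈ Finset.range M, (pod n : ℝ) * r ^ n)) :=
    tendsto_finsetSum _ fun n _ => (tendsto_coeff_podSeries n).mul_const _
  have ht2 := ht.comp (tendsto_id.const_mul_atTop' (show 0 < 2 by norm_num))
  refine le_of_tendsto' ht2 fun N => ?_
  have hs := hasSum_podSeries N (q := (r : ℂ)) (by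
    rw [Complex.norm_real, Real.norm_eq_abs, abs_of_nonneg h0]; exact h1)
  have hs' : HasSum (fun n : ℕ => (podSeries (2 * N)).coeff n * r ^ n)
      (∏ i ∈ Finset.range N, (1 + r ^ (2 * i + 1)) / (1 - r ^ (2 * i + 2))) := by
    rw [← Complex.hasSum_ofReal]
    convert hs using 1
    · ext n; push_cast; rfl
    · simp [podProd]
  refine (sum_le_hasSum _ (fun n _ => ?_) hs').trans
    (prod_div_le_exp h0 h1 (fun i => by omega) (fun i => by omega) N)
  exact mul_nonneg (coeff_podSeries_nonneg _ _) (pow_nonneg h0 _)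

/-- The generating function of `pod` is the limit of the partial products. -/
theorem tendsto_podProd {q : ℂ} (hq : ‖q‖ < 1) :
    Tendsto (fun N => podProd N q) atTop (𝓝 (∑' n : ℕ, (pod n : ℂ) * q ^ n)) := by
  have h := tendsto_tsum_of_dominated_convergence (𝓕 := atTop)
    (f := fun N n => ((podSeries (2 * N)).coeff n : ℂ) * q ^ n)
    (g := fun n : ℕ => (pod n : ℂ) * q ^ n)
    (bound := fun n : ℕ => (pod n : ℝ) * ‖q‖ ^ n)
    (summable_pod_mul_pow (norm_nonneg q) hq) (fun n => by
      refine Tendsto.mul_const _ ?_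
      have := (tendsto_coeff_podSeries n).comp
        (tendsto_id.const_mul_atTop' (show 0 < 2 by norm_num))
      exact_mod_cast (Complex.continuous_ofReal.tendsto _).comp this)
    (Eventually.of_forall fun N n => by
      rw [norm_mul, norm_pow, Complex.norm_real, Real.norm_eq_abs,
        abs_of_nonneg (coeff_podSeries_nonneg _ _)]
      gcongr
      exact coeff_podSeries_le _ _)
  simpa only [(hasSum_podSeries _ hq).tsum_eq] using h

/-! ### Gauss' theta identity -/

/-- Shanks' finite form of Gauss' identity
`∑_{m ≥ 0} Q^{m(m+1)/2} = ∏ (1 - Q^{2i+2}) / (1 - Q^{2i+1})`. The partial products enter only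
through their recursion. As `n → ∞`, only the term `s = 0` survives on the left. -/
theorem shanks_identity {Q : ℂ} {P : ℕ → ℂ} (hP : ∀ i, P i ≠ 0)
    (hQ : ∀ i : ℕ, 1 - Q ^ (2 * i + 1) ≠ 0)
    (hrec : ∀ i, P (i + 1) * (1 - Q ^ (2 * i + 1)) = P i * (1 - Q ^ (2 * i + 2))) (n : ℕ) :
    ∑ s ∈ Finset.range n, P n / P s * Q ^ (s * (2 * n + 1)) =
      ∑ m ∈ Finset.range n, (Q ^ (m * (2 * m + 1)) + Q ^ ((m + 1) * (2 * m + 1))) := by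
  induction n with
  | zero => simp
  | succ n ih =>
    have hstep : ∀ s, P (n + 1) / P s * (1 - Q ^ (2 * n + 1)) =
        P n / P s * (1 - Q ^ (2 * n + 2)) := by
      intro s
      rw [div_mul_eq_mul_div, hrec, div_mul_eq_mul_div]
    -- the difference of consecutive left-hand sides telescopes
    have htel : ∀ M, ∑ s ∈ Finset.range M, (P (n + 1) / P s * Q ^ (s * (2 * (n + 1) + 1)) -
        P n / P s * Q ^ (s * (2 * n + 1))) * (1 - Q ^ (2 * n + 1)) =
        P n / P M * Q ^ (M * (2 * n + 1)) * (1 - Q ^ (2 * M)) := by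
      intro M
      induction M with
      | zero => simp
      | succ M ihM =>
        rw [Finset.sum_range_succ, ihM]
        have e1 : P n / P (M + 1) * (1 - Q ^ (2 * (M + 1))) =
            P n / P M * (1 - Q ^ (2 * M + 1)) := by
          have := hrec M
          rw [div_mul_eq_mul_div, div_mul_eq_mul_div, div_eq_div_iff (hP _) (hP _)]
          rw [show 2 * (M + 1) = 2 * M + 2 by ring]
          linear_combination (-P n) * this
        have e2 := hstep M
        have p1 : Q ^ (M * (2 * (n + 1) + 1)) = Q ^ (M * (2 * n + 1)) * Q ^ (2 * M) := by
          rw [← pow_add]; congr 1; ring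
        have p2 : Q ^ ((M + 1) * (2 * n + 1)) = Q ^ (M * (2 * n + 1)) * Q ^ (2 * n + 1) := by
          rw [← pow_add]; congr 1; ring
        have p3 : Q ^ (2 * n + 2) = Q ^ (2 * n + 1) * Q := by rw [← pow_succ]
        have p4 : Q ^ (2 * M + 1) = Q ^ (2 * M) * Q := by rw [← pow_succ]
        rw [p1, p2]
        rw [p3] at e2
        rw [p4] at e1
        linear_combination (Q ^ (M * (2 * n + 1)) * Q ^ (2 * M)) * e2 -
          (Q ^ (M * (2 * n + 1)) * Q ^ (2 * n + 1)) * e1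
    have h1 := htel n
    rw [← Finset.sum_mul, Finset.sum_sub_distrib, ih, div_self (hP n)] at h1
    have h2 := hstep n
    rw [div_self (hP n)] at h2
    rw [Finset.sum_range_succ, Finset.sum_range_succ (fun m => Q ^ (m * (2 * m + 1)) + _)]
    refine mul_right_cancel₀ (hQ n) ?_
    have p1 : Q ^ (n * (2 * (n + 1) + 1)) = Q ^ (n * (2 * n + 1)) * Q ^ (2 * n) := by
      rw [← pow_add]; congr 1; ring
    have p2 : Q ^ ((n + 1) * (2 * n + 1)) = Q ^ (n * (2 * n + 1)) * Q ^ (2 * n + 1) := by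
      rw [← pow_add]; congr 1; ring
    have p3 : Q ^ (2 * n + 2) = Q ^ (2 * n) * Q ^ 2 := by rw [← pow_add]
    have p4 : Q ^ (2 * n + 1) = Q ^ (2 * n) * Q := by rw [← pow_succ]
    rw [p1, p2]
    rw [p3] at h2
    rw [p4] at *
    linear_combination h1 + (Q ^ (n * (2 * n + 1)) * Q ^ (2 * n)) * h2

theorem norm_podProd_le {q : ℂ} (hq : ‖q‖ < 1) (N : ℕ) :
    ‖podProd N q‖ ≤ ∏ i ∈ Finset.range N, (1 + ‖q‖ ^ (2 * i + 1)) / (1 - ‖q‖ ^ (2 * i + 2)) := by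
  rw [podProd, norm_prod]
  refine Finset.prod_le_prod (fun i _ => norm_nonneg _) fun i _ => ?_
  have h1 : ‖q‖ ^ (2 * i + 2) < 1 := pow_lt_one₀ (norm_nonneg _) hq (by omega)
  rw [norm_div]
  apply div_le_div₀ (by positivity)
  · refine (norm_add_le _ _).trans ?_
    simp
  · linarith
  · refine le_trans ?_ (norm_sub_norm_le _ _)
    simp

theorem one_sub_pow_ne_zero {q : ℂ} (hq : ‖q‖ < 1) {i : ℕ} (hi : i ≠ 0) : 1 - q ^ i ≠ 0 := by
  intro h
  have h1 : ‖q ^ i‖ < 1 := by rw [norm_pow]; exact pow_lt_one₀ (norm_nonneg _) hq hi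
  rw [← sub_eq_zero.1 h] at h1
  simp at h1

theorem one_add_pow_ne_zero {q : ℂ} (hq : ‖q‖ < 1) (i : ℕ) : 1 + q ^ (2 * i + 1) ≠ 0 := by
  have := one_sub_pow_ne_zero (q := -q) (by rwa [norm_neg]) (i := 2 * i + 1) (by omega)
  rwa [Odd.neg_pow ⟨i, rfl⟩, sub_neg_eq_add] at this

theorem podProd_ne_zero {q : ℂ} (hq : ‖q‖ < 1) (N : ℕ) : podProd N q ≠ 0 :=
  Finset.prod_ne_zero_iff.2 fun i _ =>
    div_ne_zero (one_add_pow_ne_zero hq i) (one_sub_pow_ne_zero hq (by omega))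

theorem norm_podProd_inv_le {q : ℂ} (hq : ‖q‖ < 1) (N : ℕ) :
    ‖(podProd N q)⁻¹‖ ≤
      ∏ i ∈ Finset.range N, (1 + ‖q‖ ^ (2 * i + 2)) / (1 - ‖q‖ ^ (2 * i + 1)) := by
  rw [podProd, ← Finset.prod_inv_distrib, norm_prod]
  refine Finset.prod_le_prod (fun i _ => norm_nonneg _) fun i _ => ?_
  have h1 : ‖q‖ ^ (2 * i + 1) < 1 := pow_lt_one₀ (norm_nonneg _) hq (by omega)
  rw [inv_div, norm_div]
  apply div_le_div₀ (by positivity)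
  · refine (norm_sub_le _ _).trans ?_
    simp
  · linarith
  · have := norm_sub_norm_le (1 : ℂ) (-q ^ (2 * i + 1))
    simpa using this

/-- The truncated theta series is the inverse of the partial product up to `o(1)`. -/
theorem tendsto_theta_partial_sub {q : ℂ} (hq : ‖q‖ < 1) :
    Tendsto (fun n => ∑ m ∈ Finset.range n, ((-q) ^ (m * (2 * m + 1)) +
      (-q) ^ ((m + 1) * (2 * m + 1))) - (podProd n q)⁻¹) atTop (𝓝 0) := by
  have hq' : ‖-q‖ < 1 := by rwa [norm_neg]
  set B := Real.exp (2 / (1 - ‖q‖) ^ 2) with hB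
  have hid : ∀ n : ℕ, ∑ m ∈ Finset.range (n + 1), ((-q) ^ (m * (2 * m + 1)) +
      (-q) ^ ((m + 1) * (2 * m + 1))) - (podProd (n + 1) q)⁻¹ = ∑ s ∈ Finset.range n,
      (podProd (n + 1) q)⁻¹ * podProd (s + 1) q * (-q) ^ ((s + 1) * (2 * (n + 1) + 1)) := by
    intro n
    rw [← shanks_identity (P := fun n => (podProd n q)⁻¹)
      (fun i => inv_ne_zero (podProd_ne_zero hq i)) (fun i => one_sub_pow_ne_zero hq' (by omega))]
    · rw [Finset.sum_range_succ']
      simp only [div_inv_eq_mul, zero_mul, pow_zero, mul_one]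
      simp [podProd]
    · intro i
      have h1 := one_add_pow_ne_zero hq i
      have h2 := one_sub_pow_ne_zero hq (i := 2 * i + 2) (by omega)
      have h3 := podProd_ne_zero hq i
      have h4 : podProd (i + 1) q = podProd i q *
          ((1 + q ^ (2 * i + 1)) / (1 - q ^ (2 * i + 2))) := Finset.prod_range_succ _ _
      rw [h4, Odd.neg_pow ⟨i, rfl⟩, Even.neg_pow ⟨i + 1, by ring⟩, sub_neg_eq_add]
      field_simp
  rw [← tendsto_add_atTop_iff_nat 1]
  simp_rw [hid]
  refine squeeze_zero_norm (a := fun n : ℕ => B * B * (n * ‖q‖ ^ n)) (fun n => ?_) ?_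
  · refine (norm_sum_le _ _).trans ?_
    calc ∑ s ∈ Finset.range n, ‖(podProd (n + 1) q)⁻¹ * podProd (s + 1) q *
          (-q) ^ ((s + 1) * (2 * (n + 1) + 1))‖ ≤ ∑ s ∈ Finset.range n, B * B * ‖q‖ ^ n := by
          refine Finset.sum_le_sum fun s _ => ?_
          rw [norm_mul, norm_mul, norm_pow, norm_neg]
          have b1 := (norm_podProd_inv_le hq (n + 1)).trans
            (prod_div_le_exp (norm_nonneg q) hq (fun i => by omega) (fun i => by omega) _)
          have b2 := (norm_podProd_le hq (s + 1)).trans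
            (prod_div_le_exp (norm_nonneg q) hq (fun i => by omega) (fun i => by omega) _)
          have b3 : ‖q‖ ^ ((s + 1) * (2 * (n + 1) + 1)) ≤ ‖q‖ ^ n :=
            pow_le_pow_of_le_one (norm_nonneg _) hq.le (by nlinarith)
          rw [← hB] at b1 b2
          gcongr
      _ = B * B * (n * ‖q‖ ^ n) := by
          rw [Finset.sum_const, Finset.card_range, nsmul_eq_mul]; ring
  · simpa using (tendsto_self_mul_const_pow_of_lt_one (norm_nonneg q) hq).const_mul (B * B)

/-- Gauss' identity: the generating function of `pod` is the reciprocal of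
`∑_{m ∈ ℤ} (-1)^m q^{2m² + m}`. -/
theorem podGenFun_mul_theta {q : ℂ} (hq : ‖q‖ < 1) {v : ℂ}
    (hv : Tendsto (fun n => ∑ m ∈ Finset.range n, ((-q) ^ (m * (2 * m + 1)) +
      (-q) ^ ((m + 1) * (2 * m + 1)))) atTop (𝓝 v)) :
    (∑' n : ℕ, (pod n : ℂ) * q ^ n) * v = 1 := by
  have h1 := hv.sub (tendsto_theta_partial_sub hq)
  simp only [sub_sub_cancel, sub_zero] at h1
  have h2 := (tendsto_podProd hq).mul h1
  refine tendsto_nhds_unique h2 ?_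
  simp_rw [mul_inv_cancel₀ (podProd_ne_zero hq _)]
  exact tendsto_const_nhds

/-! ### Modular transformation and the major arc -/

/-- The generating function of `pod` in the variable `t`, where `q = e^{-t}`. -/
noncomputable def podGenFun (t : ℂ) : ℂ := ∑' n : ℕ, (pod n : ℂ) * Complex.exp (-t) ^ n

theorem norm_exp_neg_lt_one {t : ℂ} (ht : 0 < t.re) : ‖Complex.exp (-t)‖ < 1 := by
  rw [Complex.norm_exp, Complex.neg_re]
  simpa using ht

/-- The parameter `τ = 2ti/π` of the upper half plane for which, with `q = e^{-t}`, the theta series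
`∑ (-1)^m q^{2m²+m}` is `jacobiTheta₂ (1 / 2 + τ / 4) τ`. -/
noncomputable def thetaTau (t : ℂ) : ℂ := 2 * t * Complex.I / Real.pi

theorem pi_mul_I_mul_thetaTau (t : ℂ) : Real.pi * Complex.I * thetaTau t = -2 * t := by
  have : (Real.pi : ℂ) ≠ 0 := by exact_mod_cast Real.pi_ne_zero
  rw [thetaTau]
  field_simp
  linear_combination t * Complex.I_sq

theorem thetaTau_im (t : ℂ) : (thetaTau t).im = 2 * t.re / Real.pi := by
  rw [thetaTau, Complex.div_ofReal_im]
  simp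

theorem tendsto_theta {t : ℂ} (ht : 0 < t.re) :
    Tendsto (fun n => ∑ m ∈ Finset.range n, ((-Complex.exp (-t)) ^ (m * (2 * m + 1)) +
      (-Complex.exp (-t)) ^ ((m + 1) * (2 * m + 1)))) atTop
      (𝓝 (jacobiTheta₂ (1 / 2 + thetaTau t / 4) (thetaTau t))) := by
  have him : 0 < (thetaTau t).im := by
    rw [thetaTau_im]; positivity
  have h := (hasSum_jacobiTheta₂_term (1 / 2 + thetaTau t / 4) him).nat_add_neg_add_one
  have hterm : ∀ n : ℤ, jacobiTheta₂_term n (1 / 2 + thetaTau t / 4) (thetaTau t) =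
      (-1) ^ n * Complex.exp (-t * (2 * n ^ 2 + n)) := by
    intro n
    rw [jacobiTheta₂_term, ← Complex.exp_pi_mul_I, ← Complex.exp_int_mul, ← Complex.exp_add]
    congr 1
    linear_combination (n / 2 + n ^ 2 : ℂ) * pi_mul_I_mul_thetaTau t
  refine h.tendsto_sum_nat.congr fun N => Finset.sum_congr rfl fun m _ => ?_
  rw [hterm, hterm, neg_pow, neg_pow (Complex.exp (-t)), ← Complex.exp_nat_mul,
    ← Complex.exp_nat_mul]
  congr 1
  · congr 1
    · rw [zpow_natCast, pow_mul', Odd.neg_one_pow ⟨m, rfl⟩]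
    · congr 1; push_cast; ring
  · congr 1
    · rw [zpow_neg, ← inv_zpow, inv_neg_one, pow_mul', Odd.neg_one_pow ⟨m, rfl⟩]
      norm_cast
    · congr 1; push_cast; ring

/-- The dual theta series is `1 + i` up to an exponentially small error: the two terms of maximal
size are those of index `0` and `1`. -/
theorem exists_dual_theta_bound : ∃ C : ℝ, 0 < C ∧ ∀ t : ℂ, 0 < t.re →
    2 ≤ (Real.pi ^ 2 / (2 * t)).re →
    ‖jacobiTheta₂ ((1 / 2 + thetaTau t / 4) / thetaTau t) (-1 / thetaTau t) - (1 + Complex.I)‖ ≤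
      C * Real.exp (-(Real.pi ^ 2 / (2 * t)).re) := by
  have hsum : Summable fun n : ℤ => Real.exp (-|(n : ℝ)|) := by
    have h1 : Summable fun n : ℕ => Real.exp (-(n : ℝ)) := Real.summable_exp_neg_nat
    apply Summable.of_nat_of_neg <;> simpa using h1
  refine ⟨∑' n : ℤ, Real.exp (-|(n : ℝ)|),
    hsum.tsum_pos (fun _ => (Real.exp_pos _).le) 0 (Real.exp_pos _), fun t ht hy => ?_⟩
  set y := (Real.pi ^ 2 / (2 * t)).re with hydef
  have ht0 : t ≠ 0 := by rintro rfl; simp at ht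
  have hpi : (Real.pi : ℂ) ≠ 0 := by exact_mod_cast Real.pi_ne_zero
  have hτ0 : thetaTau t ≠ 0 := by
    rw [thetaTau]; simp [ht0, hpi]
  have hinv : Real.pi * Complex.I / thetaTau t = Real.pi ^ 2 / (2 * t) := by
    rw [thetaTau]
    field_simp
  have him : 0 < (-1 / thetaTau t).im := by
    have h1 : -1 / thetaTau t = Complex.I * ((Real.pi ^ 2 / (2 * t)) / Real.pi) := by
      rw [← hinv]; field_simp; simp
    rw [h1, Complex.I_mul_im, Complex.div_ofReal_re, ← hydef]
    positivity
  have hterm : ∀ n : ℤ, jacobiTheta₂_term n ((1 / 2 + thetaTau t / 4) / thetaTau t)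
      (-1 / thetaTau t) =
      Complex.I ^ n * Complex.exp (-(n ^ 2 - n : ℝ) * (Real.pi ^ 2 / (2 * t))) := by
    intro n
    have hI : Complex.I ^ n = Complex.exp (n * (Real.pi / 2 * Complex.I)) := by
      rw [Complex.exp_int_mul, Complex.exp_pi_div_two_mul_I]
    rw [jacobiTheta₂_term, hI, ← Complex.exp_add, ← hinv]
    congr 1
    push_cast
    field_simp
    ring
  have hnorm : ∀ n : ℤ, ‖jacobiTheta₂_term n ((1 / 2 + thetaTau t / 4) / thetaTau t)
      (-1 / thetaTau t)‖ = Real.exp (-((n : ℝ) ^ 2 - n) * y) := by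
    intro n
    rw [hterm, norm_mul, norm_zpow, Complex.norm_I, one_zpow, one_mul, Complex.norm_exp]
    congr 1
    rw [← Complex.ofReal_neg, Complex.re_ofReal_mul]
  have hS := hasSum_jacobiTheta₂_term ((1 / 2 + thetaTau t / 4) / thetaTau t) him
  have hfin := hasSum_sum_of_ne_finset_zero (L := .unconditional ℤ) (s := ({0, 1} : Finset ℤ))
    (f := fun n : ℤ => if n ∈ ({0, 1} : Finset ℤ) then
      jacobiTheta₂_term n ((1 / 2 + thetaTau t / 4) / thetaTau t) (-1 / thetaTau t) else 0)
    (fun b hb => if_neg hb)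
  have hdiff := hS.sub hfin
  have hval : (∑ b ∈ ({0, 1} : Finset ℤ), if b ∈ ({0, 1} : Finset ℤ) then
      jacobiTheta₂_term b ((1 / 2 + thetaTau t / 4) / thetaTau t) (-1 / thetaTau t) else 0) =
      1 + Complex.I := by
    rw [Finset.sum_pair (by norm_num), if_pos (by simp), if_pos (by simp), hterm, hterm]
    simp
  rw [hval] at hdiff
  rw [← hdiff.tsum_eq]
  refine tsum_of_norm_bounded (hsum.hasSum.mul_right (Real.exp (-y))) fun n => ?_
  split_ifs with hn
  · rw [sub_self, norm_zero]; positivity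
  · rw [sub_zero, hnorm, ← Real.exp_add]
    apply Real.exp_le_exp.2
    have hn' : n ≤ -1 ∨ 2 ≤ n := by
      simp only [Finset.mem_insert, Finset.mem_singleton, not_or] at hn
      omega
    have h2 : |(n : ℝ)| ≤ 2 * ((n : ℝ) ^ 2 - n - 1) ∧ 0 ≤ (n : ℝ) ^ 2 - n - 1 := by
      rcases hn' with h | h
      · have h' : (n : ℝ) ≤ -1 := by exact_mod_cast h
        rw [abs_of_neg (by linarith)]
        constructor <;> nlinarith
      · have h' : (2 : ℝ) ≤ n := by exact_mod_cast h
        rw [abs_of_pos (by linarith)]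
        constructor <;> nlinarith
    nlinarith [mul_nonneg h2.2 (sub_nonneg.2 hy)]

theorem ofReal_mul_cpow {c : ℝ} (hc : 0 < c) {z : ℂ} (hz : z ≠ 0) (s : ℂ) :
    ((c : ℂ) * z) ^ s = (c : ℂ) ^ s * z ^ s := by
  have hc' : (c : ℂ) ≠ 0 := by exact_mod_cast hc.ne'
  rw [Complex.cpow_def_of_ne_zero (mul_ne_zero hc' hz), Complex.cpow_def_of_ne_zero hc',
    Complex.cpow_def_of_ne_zero hz, ← Complex.exp_add, Complex.log_ofReal_mul hc hz,
    Complex.ofReal_log hc.le, add_mul]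

/-- The exact transformation formula for the generating function of `pod`. -/
theorem podGenFun_eq {t : ℂ} (ht : 0 < t.re) :
    podGenFun t * jacobiTheta₂ ((1 / 2 + thetaTau t / 4) / thetaTau t) (-1 / thetaTau t) =
      (1 + Complex.I) * (t ^ (1 / 2 : ℂ) * (Real.pi : ℂ) ^ (-1 / 2 : ℂ)) *
        Complex.exp (Real.pi ^ 2 / (8 * t)) * Complex.exp (-t / 8) := by
  have h := podGenFun_mul_theta (norm_exp_neg_lt_one ht) (tendsto_theta ht)
  rw [← podGenFun, jacobiTheta₂_functional_equation] at h
  set S := jacobiTheta₂ ((1 / 2 + thetaTau t / 4) / thetaTau t) (-1 / thetaTau t)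
  have ht0 : t ≠ 0 := by rintro rfl; simp at ht
  have hpi : (Real.pi : ℂ) ≠ 0 := by exact_mod_cast Real.pi_ne_zero
  have hτ0 : thetaTau t ≠ 0 := by
    rw [thetaTau]; simp [ht0, hpi]
  have e1 : -Complex.I * thetaTau t = ((2 / Real.pi : ℝ) : ℂ) * t := by
    rw [thetaTau]; push_cast; field_simp; simp
  have e2 : ((2 / Real.pi : ℝ) : ℂ) ^ (1 / 2 : ℂ) =
      Real.sqrt 2 * (Real.pi : ℂ) ^ (-1 / 2 : ℂ) := by
    rw [Real.sqrt_eq_rpow, show (1 / 2 : ℂ) = ((1 / 2 : ℝ) : ℂ) by push_cast; rfl,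
      show (-1 / 2 : ℂ) = ((-1 / 2 : ℝ) : ℂ) by push_cast; rfl,
      ← Complex.ofReal_cpow (by positivity), ← Complex.ofReal_cpow (by positivity),
      Real.div_rpow (by norm_num) (by positivity), ← Complex.ofReal_mul, neg_div,
      Real.rpow_neg (by positivity), div_eq_mul_inv]
  have e3 : (-Complex.I * thetaTau t) ^ (1 / 2 : ℂ) =
      Real.sqrt 2 * (Real.pi : ℂ) ^ (-1 / 2 : ℂ) * t ^ (1 / 2 : ℂ) := by
    rw [e1, ofReal_mul_cpow (by positivity) ht0, e2]
  have e4 : Complex.exp (-Real.pi * Complex.I * (1 / 2 + thetaTau t / 4) ^ 2 / thetaTau t) =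
      (Complex.exp (Real.pi ^ 2 / (8 * t)) * Complex.exp (-t / 8) *
        Complex.exp (Real.pi / 4 * Complex.I))⁻¹ := by
    rw [← Complex.exp_add, ← Complex.exp_add, ← Complex.exp_neg]
    congr 1
    have : Real.pi ^ 2 / (8 * t) = Real.pi * Complex.I / (4 * thetaTau t) := by
      rw [thetaTau]; field_simp; norm_num
    rw [this]
    have h3 := pi_mul_I_mul_thetaTau t
    field_simp
    linear_combination (-32 * thetaTau t) * h3
  have e5 : Real.sqrt 2 * Complex.exp (Real.pi / 4 * Complex.I) = 1 + Complex.I := by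
    rw [Complex.exp_mul_I, show (Real.pi / 4 : ℂ) = ((Real.pi / 4 : ℝ) : ℂ) by push_cast; rfl,
      ← Complex.ofReal_cos, ← Complex.ofReal_sin, Real.cos_pi_div_four, Real.sin_pi_div_four]
    have : (Real.sqrt 2 : ℂ) * Real.sqrt 2 = 2 := by
      exact_mod_cast Real.mul_self_sqrt (by norm_num)
    push_cast
    linear_combination ((1 + Complex.I) / 2) * this
  rw [e3, e4] at h
  have n1 : (Real.sqrt 2 : ℂ) ≠ 0 := by exact_mod_cast (by positivity : Real.sqrt 2 ≠ 0)
  have n2 : (Real.pi : ℂ) ^ (-1 / 2 : ℂ) ≠ 0 := by simp [Complex.cpow_eq_zero_iff, hpi]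
  have n3 : t ^ (1 / 2 : ℂ) ≠ 0 := by simp [Complex.cpow_eq_zero_iff, ht0]
  have n4 := Complex.exp_ne_zero (Real.pi ^ 2 / (8 * t))
  have n5 := Complex.exp_ne_zero (-t / 8)
  have n6 := Complex.exp_ne_zero (Real.pi / 4 * Complex.I)
  rw [← e5]
  field_simp at h
  rw [h]
  ring_nf

/-- On the major arc the generating function of `pod` is `√(t / π) e^{π² / (8 t)} (1 + O(t))`. -/
theorem exists_podGenFun_approx : ∃ C : ℝ, 0 < C ∧ ∃ a₀ : ℝ, 0 < a₀ ∧ a₀ ≤ 1 ∧ ∀ t : ℂ, 0 < t.re →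
    t.re ≤ a₀ → |t.im| ≤ t.re →
      ‖podGenFun t - t ^ (1 / 2 : ℂ) * (Real.pi : ℂ) ^ (-1 / 2 : ℂ) *
        Complex.exp (Real.pi ^ 2 / (8 * t))‖ ≤ C * t.re *
          ‖t ^ (1 / 2 : ℂ) * (Real.pi : ℂ) ^ (-1 / 2 : ℂ) *
            Complex.exp (Real.pi ^ 2 / (8 * t))‖ := by
  obtain ⟨C, hC, hS⟩ := exists_dual_theta_bound
  refine ⟨2 * (C + 1), by positivity, 1 / (2 * (C + 1)), by positivity, ?_, fun t h0 h1 h2 => ?_⟩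
  · rw [div_le_one (by positivity)]; linarith
  have ha : t.re ≤ 1 / 2 := h1.trans (by
    apply one_div_le_one_div_of_le <;> linarith)
  have hCa : C * t.re ≤ 1 / 2 := by
    rw [le_div_iff₀ (by positivity)] at h1; nlinarith
  set a := t.re with hadef
  have hsq : t.im ^ 2 ≤ a ^ 2 := by rw [← sq_abs]; gcongr
  have hpi := Real.pi_gt_three
  have hy : 1 / a ≤ (Real.pi ^ 2 / (2 * t)).re := by
    have : (Real.pi ^ 2 / (2 * t) : ℂ) = ((Real.pi ^ 2 / 2 : ℝ) : ℂ) * t⁻¹ := by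
      push_cast
      rw [div_eq_mul_inv, mul_inv]; ring
    rw [this, Complex.re_ofReal_mul, Complex.inv_re, ← hadef, Complex.normSq_apply, ← hadef]
    have h4 : 1 / (2 * a) ≤ a / (a * a + t.im * t.im) := by
      rw [div_le_div_iff₀ (by positivity) (by nlinarith)]; nlinarith
    calc 1 / a = 2 * (1 / (2 * a)) := by field_simp
      _ ≤ Real.pi ^ 2 / 2 * (a / (a * a + t.im * t.im)) := by
        gcongr; nlinarith
  have hy2 : 2 ≤ (Real.pi ^ 2 / (2 * t)).re := by
    refine le_trans ?_ hy
    rw [le_div_iff₀ h0]; linarith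
  have hR := hS t h0 hy2
  have heq := podGenFun_eq h0
  set S := jacobiTheta₂ ((1 / 2 + thetaTau t / 4) / thetaTau t) (-1 / thetaTau t)
  set M := t ^ (1 / 2 : ℂ) * (Real.pi : ℂ) ^ (-1 / 2 : ℂ) * Complex.exp (Real.pi ^ 2 / (8 * t))
  have hexp : Real.exp (-(Real.pi ^ 2 / (2 * t)).re) ≤ a := by
    rw [Real.exp_neg, inv_le_comm₀ (Real.exp_pos _) h0, ← one_div]
    linarith [Real.add_one_le_exp (Real.pi ^ 2 / (2 * t)).re]
  have hR' : ‖S - (1 + Complex.I)‖ ≤ C * a := hR.trans (by gcongr)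
  have hI : ‖1 + Complex.I‖ = Real.sqrt 2 := by
    rw [Complex.norm_def, Complex.normSq_apply]; norm_num
  have hs1 : 1.4 ≤ Real.sqrt 2 := Real.le_sqrt_of_sq_le (by norm_num)
  have hs2 : Real.sqrt 2 ≤ 1.5 := Real.sqrt_le_iff.2 (by norm_num)
  have hSn : 0.9 ≤ ‖S‖ := by
    have := norm_sub_norm_le (1 + Complex.I) S
    rw [norm_sub_rev] at this
    linarith
  have hnt : ‖t‖ ≤ 2 * a := by
    refine (Complex.norm_le_abs_re_add_abs_im t).trans ?_
    rw [← hadef, abs_of_pos h0]; linarith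
  have hE : ‖Complex.exp (-t / 8) - 1‖ ≤ a / 2 := by
    have h5 : ‖-t / 8‖ ≤ a / 4 := by
      rw [norm_div, norm_neg]; norm_num; linarith
    refine (Complex.norm_exp_sub_one_le (h5.trans (by linarith))).trans (by linarith)
  have hprod : (podGenFun t - M) * S = M * ((1 + Complex.I) * (Complex.exp (-t / 8) - 1) -
      (S - (1 + Complex.I))) := by
    linear_combination heq
  have hnorm : ‖podGenFun t - M‖ * ‖S‖ ≤ ‖M‖ * (1.5 * (a / 2) + C * a) := by
    rw [← norm_mul, hprod, norm_mul]
    gcongr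
    refine (norm_sub_le _ _).trans ?_
    rw [norm_mul, hI]
    gcongr
  have : ‖podGenFun t - M‖ * 0.9 ≤ ‖M‖ * (1.5 * (a / 2) + C * a) := by
    refine le_trans ?_ hnorm
    gcongr
  have hCM : 0 ≤ ‖M‖ * (C * a) := by positivity
  have hM : 0 ≤ ‖M‖ * a := by positivity
  linarith

/-! ### The minor arcs -/

/-- Only the numerators `1 + q^{2i+1}` are used to gain over the trivial bound; at `q = -‖q‖` they
are small, so that no separate treatment of that point is needed. -/
theorem norm_podProd_le_exp {q : ℂ} (hq : ‖q‖ < 1) (N : ℕ) :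
    ‖podProd N q‖ ≤ (∏ i ∈ Finset.range N, (1 + ‖q‖ ^ (2 * i + 1)) / (1 - ‖q‖ ^ (2 * i + 2))) *
      Real.exp (-(1 / 4) * ∑ i ∈ Finset.range N, (‖q‖ ^ (2 * i + 1) - (q ^ (2 * i + 1)).re)) := by
  rw [podProd, norm_prod, Finset.mul_sum, Real.exp_sum, ← Finset.prod_mul_distrib]
  refine Finset.prod_le_prod (fun i _ => norm_nonneg _) fun i _ => ?_
  have h1 : ‖q‖ ^ (2 * i + 2) < 1 := pow_lt_one₀ (norm_nonneg _) hq (by omega)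
  set z := q ^ (2 * i + 1) with hz
  have hzn : ‖q‖ ^ (2 * i + 1) = ‖z‖ := by rw [hz, norm_pow]
  have hz1 : ‖z‖ ≤ 1 := by rw [← hzn]; exact pow_le_one₀ (norm_nonneg _) hq.le
  rw [norm_div, hzn, div_mul_eq_mul_div]
  apply div_le_div₀ (by positivity)
  · -- `‖1 + z‖² = (1 + ‖z‖)² - 2 (‖z‖ - Re z)`, and `(1 + ‖z‖)² ≤ 4`
    have hre : z.re ≤ ‖z‖ := Complex.re_le_norm z
    have hsq : ‖1 + z‖ ^ 2 = (1 + ‖z‖) ^ 2 - 2 * (‖z‖ - z.re) := by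
      have e1 := Complex.sq_norm z
      have e2 := Complex.sq_norm (1 + z)
      rw [Complex.normSq_apply] at e1 e2
      simp at e2
      nlinarith
    refine le_of_sq_le_sq ?_ (by positivity)
    rw [hsq, mul_pow, ← Real.exp_nat_mul]
    have h5 := Real.add_one_le_exp (((2 : ℕ) : ℝ) * (-(1 / 4) * (‖z‖ - z.re)))
    push_cast at h5 ⊢
    have h6 : (1 + ‖z‖) ^ 2 ≤ 4 := by nlinarith [norm_nonneg z]
    have h7 : (1 + ‖z‖) ^ 2 * (2 * (-(1 / 4) * (‖z‖ - z.re)) + 1) ≤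
      (1 + ‖z‖) ^ 2 * Real.exp (2 * (-(1 / 4) * (‖z‖ - z.re))) := by gcongr
    nlinarith [mul_nonneg (sub_nonneg.2 hre) (sub_nonneg.2 h6)]
  · linarith
  · refine le_trans ?_ (norm_sub_norm_le _ _)
    simp

theorem hasSum_odd_pow {K : Type*} [NormedField K] [CompleteSpace K] {q : K} (hq : ‖q‖ < 1) :
    HasSum (fun i : ℕ => q ^ (2 * i + 1)) (q / (1 - q ^ 2)) := by
  have h1 : ‖q ^ 2‖ < 1 := by
    rw [norm_pow]; exact pow_lt_one₀ (norm_nonneg _) hq (by omega)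
  rw [div_eq_mul_inv]
  refine ((hasSum_geometric_of_norm_lt_one h1).mul_left q).congr_fun fun i => ?_
  rw [pow_succ', pow_mul]

/-- Away from the positive real axis the generating function is smaller than at `‖q‖`. -/
theorem norm_podGenFun_le {q : ℂ} (hq : ‖q‖ < 1) :
    ‖∑' n : ℕ, (pod n : ℂ) * q ^ n‖ ≤ ‖∑' n : ℕ, (pod n : ℂ) * (‖q‖ : ℂ) ^ n‖ *
      Real.exp (-(1 / 4) * (‖q‖ / (1 - ‖q‖ ^ 2) - (q / (1 - q ^ 2)).re)) := by
  have hq' : ‖(‖q‖ : ℂ)‖ < 1 := by rwa [Complex.norm_real, norm_norm]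
  have hr : ‖‖q‖‖ < 1 := by rwa [norm_norm]
  have hsum := (hasSum_odd_pow hr).sub (Complex.hasSum_re (hasSum_odd_pow hq))
  have h2 := (tendsto_podProd hq').norm.mul
    ((Real.continuous_exp.tendsto _).comp (hsum.tendsto_sum_nat.const_mul (-(1 / 4))))
  refine le_of_tendsto_of_tendsto' (tendsto_podProd hq).norm h2 fun N => ?_
  refine (norm_podProd_le_exp hq N).trans (le_of_eq ?_)
  rw [Function.comp_apply]
  congr 1
  rw [podProd, norm_prod]
  refine Finset.prod_congr rfl fun i _ => ?_
  have h1 : ‖q‖ ^ (2 * i + 2) < 1 := pow_lt_one₀ (norm_nonneg _) hq (by omega)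
  have e : (1 + (‖q‖ : ℂ) ^ (2 * i + 1)) / (1 - (‖q‖ : ℂ) ^ (2 * i + 2)) =
    (((1 + ‖q‖ ^ (2 * i + 1)) / (1 - ‖q‖ ^ (2 * i + 2)) : ℝ) : ℂ) := by push_cast; rfl
  rw [e, Complex.norm_real, Real.norm_eq_abs, abs_of_nonneg]
  exact div_nonneg (by positivity) (by linarith)

/-- The real part of `q / (1 - q²) = 1 / (2 sinh t)` for `q = e^{-t}` and `t = a + iθ`. -/
theorem re_exp_div (a θ : ℝ) (ha : 0 < a) :
    (Complex.exp (-(a + θ * Complex.I)) / (1 - Complex.exp (-(a + θ * Complex.I)) ^ 2)).re =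
      Real.sinh a * Real.cos θ / (2 * (Real.sinh a ^ 2 + Real.sin θ ^ 2)) := by
  have e1 : Complex.exp (-(a + θ * Complex.I)) / (1 - Complex.exp (-(a + θ * Complex.I)) ^ 2) =
      (2 * Complex.sinh (a + θ * Complex.I))⁻¹ := by
    rw [Complex.two_sinh, Complex.exp_neg]
    have := Complex.exp_ne_zero (a + θ * Complex.I)
    by_cases h : Complex.exp (a + θ * Complex.I) ^ 2 = 1
    · have h' : Complex.exp (a + θ * Complex.I) = (Complex.exp (a + θ * Complex.I))⁻¹ := by
        exact eq_inv_of_mul_eq_one_left (by rw [← h]; ring)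
      rw [inv_pow, h, ← h']; simp
    · have h' : Complex.exp (a + θ * Complex.I) ^ 2 - 1 ≠ 0 := sub_ne_zero.2 h
      field_simp
  have e2 : 2 * Complex.sinh (a + θ * Complex.I) =
      ⟨2 * (Real.sinh a * Real.cos θ), 2 * (Real.cosh a * Real.sin θ)⟩ := by
    rw [Complex.sinh_add, Complex.cosh_mul_I, Complex.sinh_mul_I]
    apply Complex.ext <;>
    simp [← Complex.ofReal_sinh, ← Complex.ofReal_cosh, ← Complex.ofReal_sin,
      ← Complex.ofReal_cos]
  have h1 := Real.cosh_sq a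
  have h2 := Real.sin_sq_add_cos_sq θ
  have hs : 0 < Real.sinh a := Real.sinh_pos_iff.2 ha
  rw [e1, e2, Complex.inv_re, Complex.normSq_mk]
  have h3 : 2 * (Real.sinh a * Real.cos θ) * (2 * (Real.sinh a * Real.cos θ)) +
      2 * (Real.cosh a * Real.sin θ) * (2 * (Real.cosh a * Real.sin θ)) =
      2 * (2 * (Real.sinh a ^ 2 + Real.sin θ ^ 2)) := by
    linear_combination 4 * Real.sin θ ^ 2 * h1 + 4 * Real.sinh a ^ 2 * h2
  rw [h3]
  dsimp only
  rw [mul_div_mul_left _ _ (two_ne_zero)]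

theorem sinh_le_two_mul {a : ℝ} (h0 : 0 ≤ a) (h1 : a ≤ 1) : Real.sinh a ≤ 2 * a := by
  have e1 := Real.abs_exp_sub_one_le (x := a) (by rwa [abs_of_nonneg h0])
  have e2 := Real.add_one_le_exp (-a)
  rw [abs_of_nonneg h0] at e1
  have e3 := (abs_le.1 e1).2
  rw [Real.sinh_eq]
  linarith

/-- On the minor arc the generating function is exponentially smaller than on the real axis. -/
theorem norm_podGenFun_minor_le {a θ : ℝ} (ha : 0 < a) (ha1 : a ≤ 1) (hθ : a ≤ |θ|)
    (hθ' : |θ| ≤ Real.pi) :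
    ‖podGenFun (a + θ * Complex.I)‖ ≤ ‖podGenFun a‖ * Real.exp (-(1 / (400 * a))) := by
  have hn : ‖Complex.exp (-(a + θ * Complex.I))‖ = Real.exp (-a) := by
    rw [Complex.norm_exp]; simp
  have hq : ‖Complex.exp (-(a + θ * Complex.I))‖ < 1 := by
    rw [hn]; simpa using ha
  have h := norm_podGenFun_le hq
  rw [re_exp_div a θ ha, hn] at h
  have hreal : Real.exp (-a) / (1 - Real.exp (-a) ^ 2) = 1 / (2 * Real.sinh a) := by
    rw [Real.sinh_eq, Real.exp_neg]
    have h1 : 1 < Real.exp a := by simpa using ha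
    have h2 : Real.exp a ^ 2 - 1 ≠ 0 := by nlinarith
    field_simp
  rw [hreal, Complex.ofReal_exp, Complex.ofReal_neg] at h
  refine h.trans ?_
  rw [← podGenFun]
  gcongr ‖podGenFun a‖ * Real.exp ?_
  set s := Real.sinh a with hs
  have hs0 : 0 < s := Real.sinh_pos_iff.2 ha
  have hs2 : s ≤ 2 * a := sinh_le_two_mul ha.le ha1
  have h_le : 1 / (100 * a) ≤ 1 / (50 * s) := by
    apply one_div_le_one_div_of_le (by positivity); linarith
  have hmain : 1 / (50 * s) ≤
      1 / (2 * s) - s * Real.cos θ / (2 * (s ^ 2 + Real.sin θ ^ 2)) := by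
    rw [← Real.cos_abs, ← sq_abs (Real.sin θ)]
    rcases le_or_gt (|θ|) (Real.pi / 2) with hc | hc
    · have hsin : 2 / Real.pi * |θ| ≤ Real.sin |θ| := Real.mul_le_sin (abs_nonneg _) hc
      have hsa : a / 2 ≤ |Real.sin θ| := by
        rw [Real.abs_sin_eq_sqrt_one_sub_cos_sq, ← Real.cos_abs,
          ← Real.abs_sin_eq_sqrt_one_sub_cos_sq]
        refine le_trans ?_ (hsin.trans (le_abs_self _))
        have : 1 / 2 ≤ 2 / Real.pi := by
          rw [div_le_div_iff₀ (by norm_num) Real.pi_pos]; linarith [Real.pi_le_four]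
        nlinarith
      have hcos : Real.cos |θ| ≤ 1 := Real.cos_le_one _
      set σ := |Real.sin θ|
      have h16 : s ^ 2 ≤ 16 * σ ^ 2 := by nlinarith
      have : s * Real.cos |θ| / (2 * (s ^ 2 + σ ^ 2)) ≤ 1 / (2 * s) - 1 / (50 * s) := by
        rw [show 1 / (2 * s) - 1 / (50 * s) = 24 / (50 * s) by field_simp; norm_num,
          div_le_div_iff₀ (by positivity) (by positivity)]
        nlinarith [mul_nonneg (sq_nonneg s) (sub_nonneg.2 hcos)]
      linarith
    · have hcos : Real.cos |θ| ≤ 0 :=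
        Real.cos_nonpos_of_pi_div_two_le_of_le hc.le (by linarith [Real.pi_pos])
      have h1 : s * Real.cos |θ| / (2 * (s ^ 2 + |Real.sin θ| ^ 2)) ≤ 0 :=
        div_nonpos_of_nonpos_of_nonneg (mul_nonpos_of_nonneg_of_nonpos hs0.le hcos) (by positivity)
      have h2 : 1 / (50 * s) ≤ 1 / (2 * s) := by
        apply one_div_le_one_div_of_le (by positivity); linarith
      linarith
  have : 1 / (400 * a) = 1 / 4 * (1 / (100 * a)) := by field_simp; norm_num
  rw [this]
  linarith

/-! ### Cauchy's formula and the truncated theta polynomial -/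

theorem podGenFun_term_norm (a θ : ℝ) (l : ℕ) :
    ‖(pod l : ℂ) * Complex.exp (-(a + θ * Complex.I)) ^ l‖ = pod l * Real.exp (-a) ^ l := by
  rw [norm_mul, norm_pow, Complex.norm_exp, Complex.norm_natCast]
  simp

theorem summable_pod_mul_exp {a : ℝ} (ha : 0 < a) :
    Summable fun l : ℕ => (pod l : ℝ) * Real.exp (-a) ^ l :=
  summable_pod_mul_pow (Real.exp_pos _).le (by simpa using ha)

theorem continuous_podGenFun_line {a : ℝ} (ha : 0 < a) :
    Continuous fun θ : ℝ => podGenFun (a + θ * Complex.I) := by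
  unfold podGenFun
  refine continuous_tsum (fun l => by fun_prop) (summable_pod_mul_exp ha) fun l θ => ?_
  exact (podGenFun_term_norm a θ l).le

theorem integral_exp_int_mul (a : ℝ) (j : ℤ) :
    ∫ θ in -Real.pi..Real.pi, Complex.exp (j * (a + θ * Complex.I)) =
      if j = 0 then 2 * (Real.pi : ℂ) else 0 := by
  split_ifs with hj
  · subst hj
    simp
    ring
  · have h0 : (j : ℂ) * Complex.I ≠ 0 := mul_ne_zero (by exact_mod_cast hj) Complex.I_ne_zero
    have h1 : ∀ θ : ℝ, Complex.exp (j * (a + θ * Complex.I)) =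
        Complex.exp (j * a) * Complex.exp (j * Complex.I * θ) := by
      intro θ; rw [← Complex.exp_add]; congr 1; ring
    simp_rw [h1]
    rw [intervalIntegral.integral_const_mul, integral_exp_mul_complex h0]
    have h2 : Complex.exp (j * Complex.I * (Real.pi : ℝ)) =
        Complex.exp (j * Complex.I * (-Real.pi : ℝ)) := by
      rw [Complex.exp_eq_exp_iff_exists_int]
      exact ⟨j, by push_cast; ring⟩
    rw [h2]; simp

/-- Cauchy's formula for the coefficients; both sides vanish for negative `m`. -/
theorem integral_podGenFun_mul_exp {a : ℝ} (ha : 0 < a) (m : ℤ) :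
    ∫ θ in -Real.pi..Real.pi, podGenFun (a + θ * Complex.I) *
      Complex.exp (m * (a + θ * Complex.I)) = 2 * Real.pi * pod m := by
  have hterm : ∀ (l : ℕ) (θ : ℝ), (pod l : ℂ) * Complex.exp (-(a + θ * Complex.I)) ^ l *
      Complex.exp (m * (a + θ * Complex.I)) =
      (pod l : ℂ) * Complex.exp (((m - l : ℤ) : ℂ) * (a + θ * Complex.I)) := by
    intro l θ
    rw [← Complex.exp_nat_mul, mul_assoc, ← Complex.exp_add]
    congr 2; push_cast; ring
  have hnorm : ∀ (l : ℕ) (θ : ℝ), ‖(pod l : ℂ) * Complex.exp (-(a + θ * Complex.I)) ^ l *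
      Complex.exp (m * (a + θ * Complex.I))‖ =
      pod l * Real.exp (-a) ^ l * Real.exp (m * a) := by
    intro l θ
    rw [norm_mul, podGenFun_term_norm, Complex.norm_exp]
    simp
  have h := intervalIntegral.hasSum_integral_of_dominated_convergence
    (μ := volume) (a := -Real.pi) (b := Real.pi)
    (F := fun (l : ℕ) (θ : ℝ) => (pod l : ℂ) * Complex.exp (-(a + θ * Complex.I)) ^ l *
      Complex.exp (m * (a + θ * Complex.I)))
    (f := fun θ : ℝ => podGenFun (a + θ * Complex.I) * Complex.exp (m * (a + θ * Complex.I)))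
    (fun l _ => pod l * Real.exp (-a) ^ l * Real.exp (m * a))
    (fun l => Continuous.aestronglyMeasurable (by fun_prop))
    (fun l => Eventually.of_forall fun θ _ => (hnorm l θ).le)
    (Eventually.of_forall fun θ _ => (summable_pod_mul_exp ha).mul_right _)
    (by simp)
    (Eventually.of_forall fun θ _ => by
      refine HasSum.mul_right _ ?_
      refine Summable.hasSum (Summable.of_norm ?_)
      simp_rw [podGenFun_term_norm]
      exact summable_pod_mul_exp ha)
  rw [← h.tsum_eq]
  simp_rw [hterm, intervalIntegral.integral_const_mul, integral_exp_int_mul]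
  rcases m with m | m
  · rw [tsum_eq_single m]
    · simp; ring
    · intro l hl
      rw [if_neg, mul_zero]
      simp only [Int.ofNat_eq_natCast]
      omega
  · have h0 : pod (Int.negSucc m) = 0 := rfl
    rw [h0]
    simp only [Nat.cast_zero, mul_zero]
    convert tsum_zero with l
    rw [if_neg, mul_zero]
    omega

/-- The truncated theta polynomial `(-1)^{k-1} ∑_{j<k} (-1)^j (q^{j(2j+1)} - q^{(j+1)(2j+1)})`
at `q = e^{-t}`. -/
noncomputable def truncTheta (k : ℕ) (t : ℂ) : ℂ :=
  (-1) ^ (k - 1) * ∑ j ∈ Finset.range k, (-1) ^ j *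
    (Complex.exp (-(t * (j * (2 * j + 1) : ℝ))) - Complex.exp (-(t * ((j + 1) * (2 * j + 1) : ℝ))))

theorem continuous_truncTheta (k : ℕ) : Continuous (truncTheta k) := by
  unfold truncTheta; fun_prop

theorem integral_podGenFun_mul_truncTheta {a : ℝ} (ha : 0 < a) (k n : ℕ) :
    ∫ θ in -Real.pi..Real.pi, podGenFun (a + θ * Complex.I) *
      Complex.exp (n * (a + θ * Complex.I)) * truncTheta k (a + θ * Complex.I) =
        2 * Real.pi * MP k n := by
  have hcont : ∀ m : ℤ, Continuous fun θ : ℝ => podGenFun (a + θ * Complex.I) *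
      Complex.exp (m * (a + θ * Complex.I)) := fun m =>
    (continuous_podGenFun_line ha).mul (by fun_prop)
  have hexp : ∀ θ : ℝ, podGenFun (a + θ * Complex.I) *
      Complex.exp (n * (a + θ * Complex.I)) * truncTheta k (a + θ * Complex.I) =
      (-1) ^ (k - 1) * ∑ j ∈ Finset.range k, (-1) ^ j *
        (podGenFun (a + θ * Complex.I) * Complex.exp (((n - j * (2 * j + 1) : ℤ) : ℂ) *
          (a + θ * Complex.I)) - podGenFun (a + θ * Complex.I) *
          Complex.exp (((n - (j + 1) * (2 * j + 1) : ℤ) : ℂ) * (a + θ * Complex.I))) := by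
    intro θ
    rw [truncTheta, mul_left_comm, Finset.mul_sum]
    congr 1
    refine Finset.sum_congr rfl fun j _ => ?_
    have e1 : Complex.exp (((n - j * (2 * j + 1) : ℤ) : ℂ) * (a + θ * Complex.I)) =
        Complex.exp (n * (a + θ * Complex.I)) *
          Complex.exp (-((a + θ * Complex.I) * (j * (2 * j + 1) : ℝ))) := by
      rw [← Complex.exp_add]; congr 1; push_cast; ring
    have e2 : Complex.exp (((n - (j + 1) * (2 * j + 1) : ℤ) : ℂ) * (a + θ * Complex.I)) =
        Complex.exp (n * (a + θ * Complex.I)) *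
          Complex.exp (-((a + θ * Complex.I) * ((j + 1) * (2 * j + 1) : ℝ))) := by
      rw [← Complex.exp_add]; congr 1; push_cast; ring
    rw [e1, e2]
    ring
  simp_rw [hexp]
  rw [intervalIntegral.integral_const_mul, intervalIntegral.integral_finsetSum]
  · have hj : ∀ j : ℕ, ∫ θ in -Real.pi..Real.pi, (-1) ^ j *
        (podGenFun (a + θ * Complex.I) * Complex.exp (((n - j * (2 * j + 1) : ℤ) : ℂ) *
          (a + θ * Complex.I)) - podGenFun (a + θ * Complex.I) *
          Complex.exp (((n - (j + 1) * (2 * j + 1) : ℤ) : ℂ) * (a + θ * Complex.I))) =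
        2 * Real.pi * ((-1) ^ j * ((pod (n - j * (2 * j + 1)) : ℂ) -
          pod (n - (j + 1) * (2 * j + 1)))) := by
      intro j
      rw [intervalIntegral.integral_const_mul, intervalIntegral.integral_sub
        ((hcont _).intervalIntegrable _ _) ((hcont _).intervalIntegrable _ _),
        integral_podGenFun_mul_exp ha, integral_podGenFun_mul_exp ha]
      ring
    simp_rw [hj]
    rw [← Finset.mul_sum, MP]
    push_cast
    ring
  · intro j _
    exact (((hcont _).sub (hcont _)).const_mul _).intervalIntegrable _ _

theorem norm_truncTheta_le {t : ℂ} (ht : 0 ≤ t.re) (k : ℕ) : ‖truncTheta k t‖ ≤ 2 * k := by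
  have hexp : ∀ r : ℝ, 0 ≤ r → ‖Complex.exp (-(t * r))‖ ≤ 1 := by
    intro r hr
    rw [Complex.norm_exp, Real.exp_le_one_iff, Complex.neg_re, Complex.re_mul_ofReal]
    have := mul_nonneg ht hr
    linarith
  rw [truncTheta, norm_mul, norm_pow, norm_neg, norm_one, one_pow, one_mul]
  refine (norm_sum_le_of_le _ (n := fun _ => (2 : ℝ)) fun j _ => ?_).trans
    (by simp [mul_comm])
  rw [norm_mul, norm_pow, norm_neg, norm_one, one_pow, one_mul]
  refine (norm_sub_le _ _).trans ?_
  have := hexp _ (show 0 ≤ (j * (2 * j + 1) : ℝ) by positivity)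
  have := hexp _ (show 0 ≤ ((j + 1) * (2 * j + 1) : ℝ) by positivity)
  linarith

theorem norm_exp_neg_sub_one_add_le {z : ℂ} (hz : 0 ≤ z.re) :
    ‖Complex.exp (-z) - 1 + z‖ ≤ 3 * ‖z‖ ^ 2 := by
  rcases le_or_gt ‖z‖ 1 with h | h
  · have := Complex.norm_exp_sub_one_sub_id_le (x := -z) (by rwa [norm_neg])
    rw [norm_neg, sub_neg_eq_add] at this
    nlinarith [sq_nonneg ‖z‖]
  · have h1 : ‖Complex.exp (-z)‖ ≤ 1 := by
      rw [Complex.norm_exp, Real.exp_le_one_iff, Complex.neg_re]; linarith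
    have h2 := norm_add_le (Complex.exp (-z) - 1) z
    have h3 := norm_sub_le (Complex.exp (-z)) 1
    rw [norm_one] at h3
    nlinarith

theorem alternating_sum_odd (k : ℕ) :
    ∑ j ∈ Finset.range k, (-1 : ℂ) ^ j * (2 * j + 1) = -(-1) ^ k * k := by
  induction k with
  | zero => simp
  | succ k ih => rw [Finset.sum_range_succ, ih]; push_cast; ring

/-- Only the linear term of the truncated theta polynomial matters near `t = 0`. -/
theorem norm_truncTheta_sub_le {t : ℂ} (ht : 0 ≤ t.re) {k : ℕ} (hk : 1 ≤ k) :
    ‖truncTheta k t - k * t‖ ≤ 24 * (k : ℝ) ^ 5 * ‖t‖ ^ 2 := by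
  have hlin : (k : ℂ) * t =
      (-1) ^ (k - 1) * ∑ j ∈ Finset.range k, (-1) ^ j * ((2 * j + 1) * t) := by
    simp_rw [← mul_assoc]
    rw [← Finset.sum_mul, alternating_sum_odd]
    obtain ⟨m, rfl⟩ : ∃ m, k = m + 1 := ⟨k - 1, by omega⟩
    have h : ((-1 : ℂ) ^ m) * (-1) ^ m = 1 := by rw [← mul_pow]; simp
    rw [Nat.add_sub_cancel, pow_succ]
    linear_combination (-((m + 1 : ℕ) : ℂ) * t) * h
  have hexp : ∀ r : ℝ, 0 ≤ r → r ≤ 2 * (k : ℝ) ^ 2 →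
      ‖Complex.exp (-(t * r)) - 1 + t * r‖ ≤ 12 * (k : ℝ) ^ 4 * ‖t‖ ^ 2 := by
    intro r hr hrk
    refine (norm_exp_neg_sub_one_add_le ?_).trans ?_
    · rw [Complex.re_mul_ofReal]; positivity
    · rw [norm_mul, Complex.norm_real, Real.norm_eq_abs, abs_of_nonneg hr, mul_pow]
      have : r ^ 2 ≤ (2 * (k : ℝ) ^ 2) ^ 2 := by gcongr
      nlinarith [mul_nonneg (sq_nonneg ‖t‖) (sub_nonneg.2 this)]
  rw [hlin, truncTheta, ← mul_sub, ← Finset.sum_sub_distrib, norm_mul, norm_pow, norm_neg, norm_one,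
    one_pow, one_mul]
  refine (norm_sum_le_of_le _ (n := fun _ => 24 * (k : ℝ) ^ 4 * ‖t‖ ^ 2) fun j hj => ?_).trans
    (le_of_eq (by simp; ring))
  have hjk : (j : ℝ) + 1 ≤ k := by exact_mod_cast Finset.mem_range.1 hj
  have h0 : (0 : ℝ) ≤ j := Nat.cast_nonneg j
  rw [← mul_sub, norm_mul, norm_pow, norm_neg, norm_one, one_pow, one_mul]
  have b1 := hexp (j * (2 * j + 1)) (by positivity) (by nlinarith)
  have b2 := hexp ((j + 1) * (2 * j + 1)) (by positivity) (by nlinarith)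
  have e : Complex.exp (-(t * (j * (2 * j + 1) : ℝ))) -
      Complex.exp (-(t * ((j + 1) * (2 * j + 1) : ℝ))) - (2 * j + 1) * t =
      (Complex.exp (-(t * (j * (2 * j + 1) : ℝ))) - 1 + t * (j * (2 * j + 1) : ℝ)) -
      (Complex.exp (-(t * ((j + 1) * (2 * j + 1) : ℝ))) - 1 + t * ((j + 1) * (2 * j + 1) : ℝ)) := by
    push_cast; ring
  rw [e]
  refine (norm_sub_le _ _).trans ?_
  linarith

/-! ### Laplace's method on the saddle line -/

theorem norm_exp_sub_exp_le {A B : ℂ} {M : ℝ} (hA : A.re ≤ M) (hB : B.re ≤ M) :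
    ‖Complex.exp A - Complex.exp B‖ ≤ Real.exp M * ‖A - B‖ := by
  have hconv : Convex ℝ {z : ℂ | z.re ≤ M} := convex_halfSpace_re_le M
  refine hconv.norm_image_sub_le_of_norm_deriv_le (f := Complex.exp)
    (fun z _ => Complex.differentiableAt_exp) (fun z hz => ?_) hB hA
  rw [Complex.deriv_exp, Complex.norm_exp]
  exact Real.exp_le_exp.2 hz

theorem cpow_half_re_nonneg (z : ℂ) : 0 ≤ (z ^ (1 / 2 : ℂ)).re := by
  rcases eq_or_ne z 0 with rfl | hz
  · simp
  · rw [Complex.cpow_def_of_ne_zero hz, Complex.exp_re]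
    refine mul_nonneg (Real.exp_pos _).le (Real.cos_nonneg_of_mem_Icc ?_)
    have h1 := Complex.neg_pi_lt_arg z
    have h2 := Complex.arg_le_pi z
    have h3 : (Complex.log z * (1 / 2)).im = z.arg / 2 := by
      rw [show (1 / 2 : ℂ) = ((1 / 2 : ℝ) : ℂ) by push_cast; rfl, Complex.im_mul_ofReal,
        Complex.log_im]
      ring
    rw [h3]
    constructor <;> linarith

theorem cpow_half_sq (z : ℂ) : z ^ (1 / 2 : ℂ) * z ^ (1 / 2 : ℂ) = z := by
  rw [← sq, one_div]
  exact_mod_cast Complex.cpow_nat_inv_pow z two_ne_zero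

/-- The point `1 + i y` on the vertical line through the normalised saddle point. -/
noncomputable def saddleLine (y : ℝ) : ℂ := 1 + y * Complex.I

theorem saddleLine_ne_zero (y : ℝ) : saddleLine y ≠ 0 := by
  intro h
  have := congrArg Complex.re h
  simp [saddleLine] at this

theorem one_le_norm_saddleLine (y : ℝ) : 1 ≤ ‖saddleLine y‖ := by
  have := Complex.re_le_norm (saddleLine y)
  simpa [saddleLine] using this

theorem norm_saddleLine_le {y : ℝ} (hy : |y| ≤ 1) : ‖saddleLine y‖ ≤ 2 := by
  refine (norm_add_le _ _).trans ?_
  rw [norm_mul, Complex.norm_I, Complex.norm_real, Real.norm_eq_abs, norm_one]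
  linarith

/-- `u + 1/u = 2 + (u - 1)² / u`, with `u - 1 = iy`. -/
theorem saddle_phase (x y : ℝ) : (x : ℂ) * (saddleLine y + (saddleLine y)⁻¹) =
    ((2 * x : ℝ) : ℂ) + -(x * y ^ 2 : ℝ) * (saddleLine y)⁻¹ := by
  have h := saddleLine_ne_zero y
  field_simp
  rw [saddleLine]
  push_cast
  linear_combination (x * y ^ 2 : ℂ) * Complex.I_sq

theorem re_saddle_le {x y : ℝ} (hx : 0 ≤ x) (hy : |y| ≤ 1) :
    ((-(x * y ^ 2 : ℝ) : ℂ) * (saddleLine y)⁻¹).re ≤ -(x * y ^ 2 / 2) := by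
  rw [← Complex.ofReal_neg, Complex.re_ofReal_mul, Complex.inv_re, Complex.normSq_apply]
  have h1 : (saddleLine y).re = 1 := by simp [saddleLine]
  have h2 : (saddleLine y).im = y := by simp [saddleLine]
  rw [h1, h2]
  have hy2 : y * y ≤ 1 := by
    have := mul_le_mul hy hy (abs_nonneg _) zero_le_one
    rwa [abs_mul_abs_self, one_mul] at this
  have h3 : 1 / 2 ≤ 1 / (1 * 1 + y * y) := by
    apply one_div_le_one_div_of_le <;> nlinarith
  have h4 : 0 ≤ x * y ^ 2 := by positivity
  nlinarith

theorem norm_exp_saddle_le {x y : ℝ} (hx : 0 ≤ x) (hy : |y| ≤ 1) :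
    ‖Complex.exp (x * (saddleLine y + (saddleLine y)⁻¹))‖ ≤
      Real.exp (2 * x) * Real.exp (-(x / 2) * y ^ 2) := by
  rw [saddle_phase, Complex.norm_exp, ← Real.exp_add, Complex.add_re, Complex.ofReal_re]
  apply Real.exp_le_exp.2
  linarith [re_saddle_le hx hy]

theorem norm_saddle_amplitude_sub_one_le {y : ℝ} (hy : |y| ≤ 1) :
    ‖saddleLine y ^ (1 / 2 : ℂ) * saddleLine y - 1‖ ≤ 3 * |y| := by
  set u := saddleLine y with hu
  set w := u ^ (1 / 2 : ℂ) with hw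
  have h1 : ‖u - 1‖ = |y| := by
    rw [hu, saddleLine, add_sub_cancel_left, norm_mul, Complex.norm_I, Complex.norm_real,
      Real.norm_eq_abs, mul_one]
  have h2 : (w - 1) * (w + 1) = u - 1 := by
    have := cpow_half_sq u
    rw [← hw] at this
    linear_combination this
  have h3 : 1 ≤ ‖w + 1‖ := by
    refine le_trans ?_ (Complex.re_le_norm _)
    have : 0 ≤ w.re := cpow_half_re_nonneg u
    rw [Complex.add_re, Complex.one_re]
    linarith
  have h4 : ‖w - 1‖ ≤ |y| := by
    rw [← h1, ← h2, norm_mul]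
    exact le_mul_of_one_le_right (norm_nonneg _) h3
  calc ‖w * u - 1‖ = ‖(w - 1) * u + (u - 1)‖ := by congr 1; ring
    _ ≤ ‖w - 1‖ * ‖u‖ + ‖u - 1‖ := by rw [← norm_mul]; exact norm_add_le _ _
    _ ≤ |y| * 2 + |y| := by
      rw [h1]; gcongr; exact norm_saddleLine_le hy
    _ = 3 * |y| := by ring

/-- Pointwise comparison of the integrand with a Gaussian. The cubic phase error `x |y|³` is
absorbed into half of the Gaussian decay. -/
theorem norm_saddle_integrand_sub_le {x y : ℝ} (hx : 0 ≤ x) (hy : |y| ≤ 1) :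
    ‖saddleLine y ^ (1 / 2 : ℂ) * saddleLine y *
        Complex.exp (x * (saddleLine y + (saddleLine y)⁻¹)) -
      ((Real.exp (2 * x) * Real.exp (-x * y ^ 2) : ℝ) : ℂ)‖ ≤
      7 * Real.exp (2 * x) * (|y| * Real.exp (-(x / 4) * y ^ 2)) := by
  have hu0 := saddleLine_ne_zero y
  set u := saddleLine y with hu
  set A : ℂ := -(x * y ^ 2 : ℝ) * u⁻¹ with hA
  set B : ℂ := ((-x * y ^ 2 : ℝ) : ℂ) with hB
  have hAre : A.re ≤ -(x / 2) * y ^ 2 := by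
    have := re_saddle_le hx hy
    rw [← hu, ← hA] at this
    linarith
  have hxy : 0 ≤ x * y ^ 2 := by positivity
  have hBre : B.re ≤ -(x / 2) * y ^ 2 := by
    rw [hB, Complex.ofReal_re]; linarith
  have hAB : ‖A - B‖ ≤ x * y ^ 2 * |y| := by
    have : A - B = ((x * y ^ 2 : ℝ) : ℂ) * ((y : ℂ) * Complex.I * u⁻¹) := by
      rw [hA, hB]
      have : (y : ℂ) * Complex.I = u - 1 := by rw [hu, saddleLine]; ring
      rw [this]
      field_simp
      push_cast
      ring
    rw [this, norm_mul, norm_mul, norm_mul, Complex.norm_I, Complex.norm_real, Complex.norm_real,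
      Real.norm_eq_abs, Real.norm_eq_abs, abs_of_nonneg hxy, mul_one, norm_inv]
    gcongr
    exact mul_le_of_le_one_right (abs_nonneg _) (inv_le_one_of_one_le₀ (one_le_norm_saddleLine y))
  have hdiff := norm_exp_sub_exp_le hAre hBre
  have hsplit : u ^ (1 / 2 : ℂ) * u * Complex.exp (x * (u + u⁻¹)) -
      ((Real.exp (2 * x) * Real.exp (-x * y ^ 2) : ℝ) : ℂ) = ((Real.exp (2 * x) : ℝ) : ℂ) *
        ((u ^ (1 / 2 : ℂ) * u - 1) * Complex.exp A + (Complex.exp A - Complex.exp B)) := by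
    have hR : ((Real.exp (2 * x) * Real.exp (-x * y ^ 2) : ℝ) : ℂ) =
        ((Real.exp (2 * x) : ℝ) : ℂ) * Complex.exp B := by
      rw [Complex.ofReal_mul, Complex.ofReal_exp (-x * y ^ 2)]
    rw [hR, hu, saddle_phase, ← hu, ← hA, Complex.exp_add, ← Complex.ofReal_exp]
    ring
  have hexpA : ‖Complex.exp A‖ ≤ Real.exp (-(x / 2) * y ^ 2) := by
    rw [Complex.norm_exp]; exact Real.exp_le_exp.2 hAre
  have hhalf : Real.exp (-(x / 2) * y ^ 2) =
      Real.exp (-(x / 4) * y ^ 2) * Real.exp (-(x / 4) * y ^ 2) := by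
    rw [← Real.exp_add]; congr 1; ring
  have hle1 : Real.exp (-(x / 4) * y ^ 2) ≤ 1 := by
    rw [Real.exp_le_one_iff]; linarith
  have habs : Real.exp (-(x / 4) * y ^ 2) * (x * y ^ 2) ≤ 4 := by
    have h1 := Real.add_one_le_exp (x / 4 * y ^ 2)
    have h2 : Real.exp (-(x / 4) * y ^ 2) * Real.exp (x / 4 * y ^ 2) = 1 := by
      rw [← Real.exp_add]; simp
    nlinarith [Real.exp_pos (-(x / 4) * y ^ 2)]
  rw [hsplit, norm_mul, Complex.norm_real, Real.norm_eq_abs, abs_of_pos (Real.exp_pos _)]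
  have hsum : ‖(u ^ (1 / 2 : ℂ) * u - 1) * Complex.exp A + (Complex.exp A - Complex.exp B)‖ ≤
      7 * (|y| * Real.exp (-(x / 4) * y ^ 2)) := by
    refine (norm_add_le _ _).trans ?_
    rw [norm_mul]
    have e1 : ‖u ^ (1 / 2 : ℂ) * u - 1‖ * ‖Complex.exp A‖ ≤
        3 * |y| * Real.exp (-(x / 4) * y ^ 2) := by
      refine mul_le_mul (norm_saddle_amplitude_sub_one_le hy) (hexpA.trans ?_) (norm_nonneg _)
        (by positivity)
      rw [hhalf]
      exact mul_le_of_le_one_right (Real.exp_pos _).le hle1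
    have e2 : ‖Complex.exp A - Complex.exp B‖ ≤ 4 * |y| * Real.exp (-(x / 4) * y ^ 2) := by
      refine hdiff.trans ?_
      calc Real.exp (-(x / 2) * y ^ 2) * ‖A - B‖
          ≤ Real.exp (-(x / 2) * y ^ 2) * (x * y ^ 2 * |y|) := by gcongr
        _ = (Real.exp (-(x / 4) * y ^ 2) * (x * y ^ 2)) * (|y| * Real.exp (-(x / 4) * y ^ 2)) := by
          rw [hhalf]; ring
        _ ≤ 4 * (|y| * Real.exp (-(x / 4) * y ^ 2)) := by gcongr
        _ = _ := by ring
    linarith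
  calc _ ≤ Real.exp (2 * x) * (7 * (|y| * Real.exp (-(x / 4) * y ^ 2))) := by gcongr
    _ = _ := by ring

theorem integrable_abs_mul_exp {b : ℝ} (hb : 0 < b) :
    Integrable fun y : ℝ => |y| * Real.exp (-b * y ^ 2) := by
  have := (integrable_mul_exp_neg_mul_sq hb).norm
  simpa [abs_mul] using this

theorem integral_abs_mul_exp {b : ℝ} (hb : 0 < b) :
    ∫ y : ℝ, |y| * Real.exp (-b * y ^ 2) = 1 / b := by
  have h1 := integral_comp_abs (f := fun s : ℝ => s * Real.exp (-b * s ^ 2))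
  simp only [sq_abs] at h1
  rw [h1]
  have h2 := integral_mul_cexp_neg_mul_sq (b := (b : ℂ)) (by simpa using hb)
  have h3 : ((∫ y in Set.Ioi (0 : ℝ), y * Real.exp (-b * y ^ 2) : ℝ) : ℂ) =
      (((2 * b)⁻¹ : ℝ) : ℂ) := by
    rw [← integral_complex_ofReal]
    push_cast
    exact h2
  rw [Complex.ofReal_inj.1 h3]
  field_simp

theorem setIntegral_abs_mul_exp_le {b : ℝ} (hb : 0 < b) (s : Set ℝ) :
    ∫ y in s, |y| * Real.exp (-b * y ^ 2) ≤ 1 / b := by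
  rw [← integral_abs_mul_exp hb]
  exact setIntegral_le_integral (integrable_abs_mul_exp hb)
    (Eventually.of_forall fun y => by positivity)

/-- The tail `|y| > 1` of the Gaussian is dominated by `|y| e^{-x y²}`. -/
theorem abs_integral_gaussian_sub_le {x : ℝ} (hx : 0 < x) :
    |(∫ y in (-1 : ℝ)..1, Real.exp (-x * y ^ 2)) - Real.sqrt (Real.pi / x)| ≤ 1 / x := by
  have hint := integrable_exp_neg_mul_sq hx
  have hsplit := integral_add_compl (s := Set.Ioc (-1 : ℝ) 1) measurableSet_Ioc hint
  rw [intervalIntegral.integral_of_le (by norm_num), ← integral_gaussian x, ← hsplit,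
    sub_add_cancel_left, abs_neg, abs_of_nonneg (integral_nonneg fun y => (Real.exp_pos _).le)]
  refine le_trans ?_ (setIntegral_abs_mul_exp_le hx (Set.Ioc (-1 : ℝ) 1)ᶜ)
  refine setIntegral_mono_on hint.integrableOn (integrable_abs_mul_exp hx).integrableOn
    measurableSet_Ioc.compl fun y hy => ?_
  have : 1 ≤ |y| := by
    rw [Set.mem_compl_iff, Set.mem_Ioc, not_and_or, not_lt, not_le] at hy
    rcases hy with h | h
    · exact le_abs.2 (Or.inr (by linarith))
    · exact le_abs.2 (Or.inl h.le)
  exact le_mul_of_one_le_left (Real.exp_pos _).le this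

theorem integral_gaussian_le {x : ℝ} (hx : 0 < x) :
    ∫ y in (-1 : ℝ)..1, Real.exp (-x * y ^ 2) ≤ Real.sqrt (Real.pi / x) := by
  rw [intervalIntegral.integral_of_le (by norm_num), ← integral_gaussian x]
  exact setIntegral_le_integral (integrable_exp_neg_mul_sq hx)
    (Eventually.of_forall fun y => (Real.exp_pos _).le)

theorem continuous_saddleLine : Continuous saddleLine := by
  unfold saddleLine; fun_prop

theorem continuous_saddle_integrand (x : ℝ) :
    Continuous fun y : ℝ => saddleLine y ^ (1 / 2 : ℂ) * saddleLine y *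
        Complex.exp (x * (saddleLine y + (saddleLine y)⁻¹)) := by
  have h := continuous_saddleLine
  refine (Continuous.mul (Continuous.cpow h continuous_const fun y => ?_) h).mul
    ((continuous_const.mul (h.add (h.inv₀ saddleLine_ne_zero))).cexp)
  left
  simp [saddleLine]

/-- Laplace's method for `∫ u^{3/2} e^{x (u + 1/u)}` along the vertical line through the saddle
point `u = 1`. -/
theorem norm_integral_saddle_sub_le {x : ℝ} (hx : 0 < x) :
    ‖(∫ y in (-1 : ℝ)..1, saddleLine y ^ (1 / 2 : ℂ) * saddleLine y *
        Complex.exp (x * (saddleLine y + (saddleLine y)⁻¹))) -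
      ((Real.exp (2 * x) * Real.sqrt (Real.pi / x) : ℝ) : ℂ)‖ ≤ 29 * Real.exp (2 * x) / x := by
  have hc1 : Continuous fun y : ℝ => ((Real.exp (2 * x) * Real.exp (-x * y ^ 2) : ℝ) : ℂ) := by
    fun_prop
  have hI : ∫ y in (-1 : ℝ)..1, ((Real.exp (2 * x) * Real.exp (-x * y ^ 2) : ℝ) : ℂ) =
      ((Real.exp (2 * x) * ∫ y in (-1 : ℝ)..1, Real.exp (-x * y ^ 2) : ℝ) : ℂ) := by
    rw [intervalIntegral.integral_ofReal, intervalIntegral.integral_const_mul]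
  have h1 : ‖(∫ y in (-1 : ℝ)..1, saddleLine y ^ (1 / 2 : ℂ) * saddleLine y *
        Complex.exp (x * (saddleLine y + (saddleLine y)⁻¹))) -
      ∫ y in (-1 : ℝ)..1, ((Real.exp (2 * x) * Real.exp (-x * y ^ 2) : ℝ) : ℂ)‖ ≤
      28 * Real.exp (2 * x) / x := by
    rw [← intervalIntegral.integral_sub ((continuous_saddle_integrand x).intervalIntegrable _ _)
      (hc1.intervalIntegrable _ _)]
    have hg : Continuous fun y : ℝ =>
        7 * Real.exp (2 * x) * (|y| * Real.exp (-(x / 4) * y ^ 2)) := by fun_prop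
    refine (intervalIntegral.norm_integral_le_of_norm_le (by norm_num)
      (Eventually.of_forall fun y hy => norm_saddle_integrand_sub_le hx.le ?_)
      (hg.intervalIntegrable _ _)).trans ?_
    · exact abs_le.2 ⟨hy.1.le, hy.2⟩
    · rw [intervalIntegral.integral_const_mul, intervalIntegral.integral_of_le (by norm_num)]
      have := setIntegral_abs_mul_exp_le (show 0 < x / 4 by positivity) (Set.Ioc (-1 : ℝ) 1)
      calc _ ≤ 7 * Real.exp (2 * x) * (1 / (x / 4)) := by gcongr
        _ = _ := by field_simp; norm_num
  rw [hI] at h1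
  have h2 : ‖((Real.exp (2 * x) * ∫ y in (-1 : ℝ)..1, Real.exp (-x * y ^ 2) : ℝ) : ℂ) -
      ((Real.exp (2 * x) * Real.sqrt (Real.pi / x) : ℝ) : ℂ)‖ ≤ Real.exp (2 * x) / x := by
    rw [← Complex.ofReal_sub, Complex.norm_real, ← mul_sub, Real.norm_eq_abs, abs_mul,
      abs_of_pos (Real.exp_pos _)]
    exact (mul_le_mul_of_nonneg_left (abs_integral_gaussian_sub_le hx)
      (Real.exp_pos _).le).trans_eq (mul_one_div _ _)
  calc _ ≤ 28 * Real.exp (2 * x) / x + Real.exp (2 * x) / x := by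
        refine (norm_sub_le_norm_sub_add_norm_sub _ _ _).trans (add_le_add h1 h2)
    _ = _ := by ring

/-! ### Assembling the circle method -/

/-- The main term `√(t / π) e^{π² / (8 t)}` of the generating function near `t = 0`. -/
noncomputable def podMain (t : ℂ) : ℂ :=
  t ^ (1 / 2 : ℂ) * (Real.pi : ℂ) ^ (-1 / 2 : ℂ) * Complex.exp (Real.pi ^ 2 / (8 * t))

theorem pi_cpow_neg_half : (Real.pi : ℂ) ^ (-1 / 2 : ℂ) = (((Real.sqrt Real.pi)⁻¹ : ℝ) : ℂ) := by
  rw [show (-1 / 2 : ℂ) = ((-1 / 2 : ℝ) : ℂ) by push_cast; rfl,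
    ← Complex.ofReal_cpow Real.pi_pos.le, Real.sqrt_eq_rpow, ← Real.rpow_neg Real.pi_pos.le]
  norm_num

theorem ofReal_cpow_half {a : ℝ} (ha : 0 ≤ a) : (a : ℂ) ^ (1 / 2 : ℂ) = (Real.sqrt a : ℂ) := by
  rw [show (1 / 2 : ℂ) = ((1 / 2 : ℝ) : ℂ) by push_cast; rfl, ← Complex.ofReal_cpow ha,
    Real.sqrt_eq_rpow]

/-- The hypotheses express that `a` is the saddle point of `π² / (8 t) + n t`, where this function
takes the value `2 x`. -/
theorem podMain_mul_exp {a x : ℝ} {n : ℕ} (ha : 0 < a) (hn : n * a = x)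
    (hx : Real.pi ^ 2 / 8 = x * a) (y : ℝ) :
    podMain (a * saddleLine y) * Complex.exp (n * (a * saddleLine y)) =
      ((Real.sqrt a * (Real.sqrt Real.pi)⁻¹ : ℝ) : ℂ) * (saddleLine y ^ (1 / 2 : ℂ) *
        Complex.exp (x * (saddleLine y + (saddleLine y)⁻¹))) := by
  have hu := saddleLine_ne_zero y
  have hac : (a : ℂ) ≠ 0 := by exact_mod_cast ha.ne'
  rw [podMain, mul_assoc, ← Complex.exp_add, ofReal_mul_cpow ha hu, ofReal_cpow_half ha.le,
    pi_cpow_neg_half]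
  have e : (Real.pi ^ 2 / (8 * (a * saddleLine y)) + n * (a * saddleLine y) : ℂ) =
      x * (saddleLine y + (saddleLine y)⁻¹) := by
    have h1 : (Real.pi ^ 2 / 8 : ℂ) = x * a := by exact_mod_cast hx
    have h2 : (n * a : ℂ) = x := by exact_mod_cast hn
    have h3 : (Real.pi ^ 2 / (8 * (a * saddleLine y)) : ℂ) = x * (saddleLine y)⁻¹ := by
      rw [← div_div, h1]; field_simp
    rw [h3, ← mul_assoc, h2]; ring
  rw [e]
  push_cast
  ring

theorem norm_podMain_mul_exp_le {a x : ℝ} {n : ℕ} (ha : 0 < a) (hn : n * a = x)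
    (hx : Real.pi ^ 2 / 8 = x * a) {y : ℝ} (hy : |y| ≤ 1) :
    ‖podMain (a * saddleLine y) * Complex.exp (n * (a * saddleLine y))‖ ≤
      2 * Real.sqrt a * Real.exp (2 * x) * Real.exp (-(x / 2) * y ^ 2) := by
  have hx0 : 0 ≤ x := by rw [← hn]; positivity
  rw [podMain_mul_exp ha hn hx, norm_mul, norm_mul, Complex.norm_real, Real.norm_eq_abs,
    abs_of_nonneg (by positivity)]
  have h1 : ‖saddleLine y ^ (1 / 2 : ℂ)‖ ≤ 2 := by
    have := congrArg norm (cpow_half_sq (saddleLine y))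
    rw [norm_mul] at this
    have h2 := norm_saddleLine_le hy
    nlinarith [norm_nonneg (saddleLine y ^ (1 / 2 : ℂ))]
  have h2 : (Real.sqrt Real.pi)⁻¹ ≤ 1 := by
    apply inv_le_one_of_one_le₀
    rw [Real.one_le_sqrt]; linarith [Real.pi_gt_three]
  have h3 := norm_exp_saddle_le hx0 hy
  calc _ ≤ (Real.sqrt a * 1) * (2 * (Real.exp (2 * x) * Real.exp (-(x / 2) * y ^ 2))) := by
        gcongr
    _ = _ := by ring

/-- The integrand of Cauchy's formula for `MP k n`, on the vertical line `re t = a`. -/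
noncomputable def cauchyIntegrand (k n : ℕ) (a θ : ℝ) : ℂ :=
  podGenFun (a + θ * Complex.I) * Complex.exp (n * (a + θ * Complex.I)) *
    truncTheta k (a + θ * Complex.I)

theorem continuous_cauchyIntegrand (k n : ℕ) {a : ℝ} (ha : 0 < a) :
    Continuous (cauchyIntegrand k n a) := by
  unfold cauchyIntegrand
  exact ((continuous_podGenFun_line ha).mul (by fun_prop)).mul
    ((continuous_truncTheta k).comp (by fun_prop))

theorem saddleLine_eq (a y : ℝ) : (a : ℂ) + ((a * y : ℝ) : ℂ) * Complex.I = a * saddleLine y := by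
  rw [saddleLine]; push_cast; ring

/-- On the major arc `θ = a y`, `|y| ≤ 1`, the integrand is the product of the main terms of its
factors, up to a relative error `O(k⁴ a)`. -/
theorem exists_cauchyIntegrand_major : ∃ C : ℝ, 0 < C ∧ ∃ a₀ : ℝ, 0 < a₀ ∧ a₀ ≤ 1 ∧
    ∀ (a x : ℝ) (n k : ℕ), 0 < a → a ≤ a₀ → n * a = x → Real.pi ^ 2 / 8 = x * a → 1 ≤ k →
      ∀ y : ℝ, |y| ≤ 1 →
      ‖cauchyIntegrand k n a (a * y) - ((k * a * (Real.sqrt a * (Real.sqrt Real.pi)⁻¹) : ℝ) : ℂ) *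
        (saddleLine y ^ (1 / 2 : ℂ) * saddleLine y *
          Complex.exp (x * (saddleLine y + (saddleLine y)⁻¹)))‖ ≤
      C * (k ^ 5 * a ^ 2 * Real.sqrt a) * Real.exp (2 * x) * Real.exp (-(x / 2) * y ^ 2) := by
  obtain ⟨C, hC, a₀, h0, h1, happ⟩ := exists_podGenFun_approx
  refine ⟨2 * (98 * C + 96), by positivity, a₀, h0, h1, ?_⟩
  intro a x n k ha haa hn hx hk y hy
  have hk1 : (1 : ℝ) ≤ k := by exact_mod_cast hk
  have hmain : ((k * a * (Real.sqrt a * (Real.sqrt Real.pi)⁻¹) : ℝ) : ℂ) *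
        (saddleLine y ^ (1 / 2 : ℂ) * saddleLine y *
          Complex.exp (x * (saddleLine y + (saddleLine y)⁻¹))) =
      podMain (a * saddleLine y) * Complex.exp (n * (a * saddleLine y)) *
        (k * (a * saddleLine y)) := by
    rw [podMain_mul_exp ha hn hx]
    push_cast
    ring
  have hM := norm_podMain_mul_exp_le ha hn hx hy
  rw [hmain, cauchyIntegrand, saddleLine_eq]
  set t : ℂ := a * saddleLine y with ht
  have hre : t.re = a := by rw [ht, Complex.re_ofReal_mul]; simp [saddleLine]
  have him : t.im = a * y := by rw [ht, Complex.im_ofReal_mul]; simp [saddleLine]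
  have hnt : ‖t‖ ≤ 2 * a := by
    rw [ht, norm_mul, Complex.norm_real, Real.norm_eq_abs, abs_of_pos ha, mul_comm]
    gcongr
    exact norm_saddleLine_le hy
  have hG := happ t (by rwa [hre]) (by rwa [hre]) (by
    rw [hre, him, abs_mul, abs_of_pos ha]
    exact mul_le_of_le_one_right ha.le hy)
  rw [← podMain, hre] at hG
  have hP2 := norm_truncTheta_sub_le (t := t) (by rw [hre]; exact ha.le) hk
  have hP3 : ‖truncTheta k t - k * t‖ ≤ 96 * k ^ 5 * a ^ 2 := by
    refine hP2.trans ?_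
    have : ‖t‖ ^ 2 ≤ (2 * a) ^ 2 := by gcongr
    nlinarith [mul_nonneg (show (0 : ℝ) ≤ k ^ 5 by positivity) (sub_nonneg.2 this)]
  have hP4 : ‖truncTheta k t‖ ≤ 2 * k * a + 96 * k ^ 5 * a ^ 2 := by
    have h2 : truncTheta k t = k * t + (truncTheta k t - k * t) := by ring
    rw [h2]
    refine (norm_add_le _ _).trans (add_le_add ?_ hP3)
    rw [norm_mul, Complex.norm_natCast]
    nlinarith
  have hk5 : (k : ℝ) ≤ k ^ 5 := le_self_pow₀ hk1 (by norm_num)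
  have ha1 : a ≤ 1 := haa.trans h1
  have hP5 : a * ‖truncTheta k t‖ ≤ 98 * (k ^ 5 * a ^ 2) := by
    have e1 : a * ‖truncTheta k t‖ ≤ a * (2 * k * a + 96 * k ^ 5 * a ^ 2) := by gcongr
    have e2 : (k : ℝ) * a ^ 2 ≤ k ^ 5 * a ^ 2 := by gcongr
    have e3 : a * (k ^ 5 * a ^ 2) ≤ 1 * (k ^ 5 * a ^ 2) := by gcongr
    nlinarith
  calc ‖podGenFun t * Complex.exp (n * t) * truncTheta k t -
        podMain t * Complex.exp (n * t) * (k * t)‖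
      = ‖Complex.exp (n * t)‖ *
        ‖(podGenFun t - podMain t) * truncTheta k t + podMain t * (truncTheta k t - k * t)‖ := by
        rw [← norm_mul]; congr 1; ring
    _ ≤ ‖Complex.exp (n * t)‖ * (C * a * ‖podMain t‖ * ‖truncTheta k t‖ +
        ‖podMain t‖ * (96 * k ^ 5 * a ^ 2)) := by
        gcongr
        refine (norm_add_le _ _).trans ?_
        rw [norm_mul, norm_mul]
        gcongr
    _ = ‖podMain t * Complex.exp (n * t)‖ * (C * (a * ‖truncTheta k t‖) +
        96 * (k ^ 5 * a ^ 2)) := by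
        rw [norm_mul]; ring
    _ ≤ (2 * Real.sqrt a * Real.exp (2 * x) * Real.exp (-(x / 2) * y ^ 2)) *
        (C * (98 * (k ^ 5 * a ^ 2)) + 96 * (k ^ 5 * a ^ 2)) := by gcongr
    _ = _ := by ring

theorem exists_integral_major : ∃ C : ℝ, 0 < C ∧ ∃ a₀ : ℝ, 0 < a₀ ∧ a₀ ≤ 1 ∧
    ∀ (a x : ℝ) (n k : ℕ), 0 < a → a ≤ a₀ → n * a = x → Real.pi ^ 2 / 8 = x * a → 1 ≤ k →
      ‖(∫ θ in -a..a, cauchyIntegrand k n a θ) -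
        ((k * a ^ 3 * (Real.sqrt 8 / Real.pi) * Real.exp (2 * x) : ℝ) : ℂ)‖ ≤
      C * (k * (a ^ 3 * Real.sqrt a) + k ^ 5 * a ^ 4) * Real.exp (2 * x) := by
  obtain ⟨C, hC, a₀, h0, h1, hmaj⟩ := exists_cauchyIntegrand_major
  refine ⟨29 + 3 * C, by positivity, a₀, h0, h1, ?_⟩
  intro a x n k ha haa hn hx hk
  have hpi := Real.pi_gt_three
  have hpi0 := Real.pi_pos
  have hx0 : 0 < x := by
    have : 0 < x * a := by rw [← hx]; positivity
    exact pos_of_mul_pos_left this ha.le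
  have hxinv : 1 / x ≤ a := by
    rw [div_le_iff₀ hx0, mul_comm, ← hx]; nlinarith
  have hxa : Real.pi / x = 8 * a / Real.pi := by
    rw [div_eq_div_iff hx0.ne' hpi0.ne']; nlinarith
  have hsa : Real.sqrt a * Real.sqrt a = a := Real.mul_self_sqrt ha.le
  set c : ℝ := k * a * (Real.sqrt a * (Real.sqrt Real.pi)⁻¹) with hc
  have hsubst : ∫ θ in -a..a, cauchyIntegrand k n a θ =
      a * ∫ y in (-1 : ℝ)..1, cauchyIntegrand k n a (a * y) := by
    have := intervalIntegral.smul_integral_comp_mul_left (a := -1) (b := 1)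
      (cauchyIntegrand k n a) a
    rw [mul_neg_one, mul_one] at this
    rw [← this, Complex.real_smul]
  set I₀ := ∫ y in (-1 : ℝ)..1, saddleLine y ^ (1 / 2 : ℂ) * saddleLine y *
    Complex.exp (x * (saddleLine y + (saddleLine y)⁻¹)) with hI0
  have hcont : Continuous fun y : ℝ => cauchyIntegrand k n a (a * y) :=
    (continuous_cauchyIntegrand k n ha).comp (by fun_prop)
  have hA : ‖(∫ y in (-1 : ℝ)..1, cauchyIntegrand k n a (a * y)) - (c : ℂ) * I₀‖ ≤
      C * (k ^ 5 * a ^ 2 * Real.sqrt a) * Real.exp (2 * x) * (3 * Real.sqrt a) := by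
    rw [hI0, ← intervalIntegral.integral_const_mul, ← intervalIntegral.integral_sub
      (hcont.intervalIntegrable _ _)
      (((continuous_saddle_integrand x).const_mul _).intervalIntegrable _ _)]
    have hg : Continuous fun y : ℝ => C * (k ^ 5 * a ^ 2 * Real.sqrt a) * Real.exp (2 * x) *
      Real.exp (-(x / 2) * y ^ 2) := by fun_prop
    refine (intervalIntegral.norm_integral_le_of_norm_le (by norm_num)
      (Eventually.of_forall fun y hy => hmaj a x n k ha haa hn hx hk y
        (abs_le.2 ⟨hy.1.le, hy.2⟩)) (hg.intervalIntegrable _ _)).trans ?_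
    rw [intervalIntegral.integral_const_mul]
    gcongr
    refine (integral_gaussian_le (half_pos hx0)).trans ?_
    rw [Real.sqrt_le_left (by positivity), mul_pow, sq (Real.sqrt a), hsa]
    have : Real.pi / (x / 2) = 2 * (8 * a / Real.pi) := by rw [← hxa]; field_simp
    rw [this, ← mul_div_assoc, div_le_iff₀ hpi0]
    nlinarith
  have hB := norm_integral_saddle_sub_le hx0
  rw [← hI0] at hB
  have hc0 : 0 ≤ c := by positivity
  have hsp : (Real.sqrt Real.pi)⁻¹ ≤ 1 := by
    apply inv_le_one_of_one_le₀
    rw [Real.one_le_sqrt]; linarith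
  have hcle : c ≤ k * a * Real.sqrt a := by
    rw [hc]
    gcongr
    exact mul_le_of_le_one_right (Real.sqrt_nonneg _) hsp
  have hval : a * (c * (Real.exp (2 * x) * Real.sqrt (Real.pi / x))) =
      k * a ^ 3 * (Real.sqrt 8 / Real.pi) * Real.exp (2 * x) := by
    have hspp : Real.sqrt Real.pi * Real.sqrt Real.pi = Real.pi := Real.mul_self_sqrt hpi0.le
    have hsp0 : Real.sqrt Real.pi ≠ 0 := by positivity
    have : Real.sqrt 8 / Real.pi = (Real.sqrt Real.pi)⁻¹ * (Real.sqrt 8 / Real.sqrt Real.pi) := by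
      field_simp
      rw [sq, hspp]
    rw [hxa, Real.sqrt_div (by positivity), Real.sqrt_mul (by norm_num), this, hc]
    linear_combination (k * a ^ 2 * (Real.sqrt Real.pi)⁻¹ * (Real.sqrt 8 / Real.sqrt Real.pi) *
      Real.exp (2 * x)) * hsa
  have hdec : (∫ θ in -a..a, cauchyIntegrand k n a θ) -
        ((k * a ^ 3 * (Real.sqrt 8 / Real.pi) * Real.exp (2 * x) : ℝ) : ℂ) =
      a * ((∫ y in (-1 : ℝ)..1, cauchyIntegrand k n a (a * y)) - (c : ℂ) * I₀) +
      ((a * c : ℝ) : ℂ) * (I₀ - ((Real.exp (2 * x) * Real.sqrt (Real.pi / x) : ℝ) : ℂ)) := by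
    rw [hsubst, ← hval]
    push_cast
    ring
  rw [hdec]
  refine (norm_add_le _ _).trans ?_
  rw [norm_mul, norm_mul, Complex.norm_real, Complex.norm_real, Real.norm_eq_abs, Real.norm_eq_abs,
    abs_of_pos ha, abs_of_nonneg (mul_nonneg ha.le hc0)]
  have t1 : a * ‖(∫ y in (-1 : ℝ)..1, cauchyIntegrand k n a (a * y)) - (c : ℂ) * I₀‖ ≤
      3 * C * (k ^ 5 * a ^ 4) * Real.exp (2 * x) := by
    calc _ ≤ a * (C * (k ^ 5 * a ^ 2 * Real.sqrt a) * Real.exp (2 * x) * (3 * Real.sqrt a)) := by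
          gcongr
      _ = _ := by linear_combination (3 * C * k ^ 5 * a ^ 3 * Real.exp (2 * x)) * hsa
  have t2 : a * c * ‖I₀ - ((Real.exp (2 * x) * Real.sqrt (Real.pi / x) : ℝ) : ℂ)‖ ≤
      29 * (k * (a ^ 3 * Real.sqrt a)) * Real.exp (2 * x) := by
    calc _ ≤ a * (k * a * Real.sqrt a) * (29 * Real.exp (2 * x) * (1 / x)) := by
          rw [mul_one_div]; gcongr
      _ ≤ a * (k * a * Real.sqrt a) * (29 * Real.exp (2 * x) * a) := by gcongr
      _ = _ := by ring
  have p1 : 0 ≤ C * (k * (a ^ 3 * Real.sqrt a)) * Real.exp (2 * x) := by positivity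
  have p2 : 0 ≤ k ^ 5 * a ^ 4 * Real.exp (2 * x) := by positivity
  linarith

/-- On the minor arcs the integrand is smaller than the main term by a factor `e^{-c/a}`, which
beats every power of `a`. -/
theorem exists_cauchyIntegrand_minor : ∃ C : ℝ, 0 < C ∧ ∃ a₀ : ℝ, 0 < a₀ ∧ a₀ ≤ 1 ∧
    ∀ (a x : ℝ) (n k : ℕ), 0 < a → a ≤ a₀ → n * a = x → Real.pi ^ 2 / 8 = x * a →
      ∀ θ : ℝ, a ≤ |θ| → |θ| ≤ Real.pi →
      ‖cauchyIntegrand k n a θ‖ ≤ C * (k * (a ^ 3 * Real.sqrt a)) * Real.exp (2 * x) := by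
  obtain ⟨C, hC, a₀, h0, h1, happ⟩ := exists_podGenFun_approx
  refine ⟨2 * (1 + C) * (24 * 400 ^ 4), by positivity, a₀, h0, h1, ?_⟩
  intro a x n k ha haa hn hx θ hθ hθ'
  have ha1 := haa.trans h1
  have hG := happ a (by simpa using ha) (by simpa using haa) (by simpa using ha.le)
  rw [← podMain, Complex.ofReal_re] at hG
  have hM : ‖podMain a‖ ≤ Real.exp x := by
    rw [podMain, ofReal_cpow_half ha.le, pi_cpow_neg_half, norm_mul, norm_mul, Complex.norm_real,
      Complex.norm_real, Complex.norm_exp]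
    have e : (Real.pi ^ 2 / (8 * a) : ℂ) = ((x : ℝ) : ℂ) := by
      have : Real.pi ^ 2 / (8 * a) = x := by
        rw [div_eq_iff (by positivity)]; linarith
      exact_mod_cast this
    rw [e, Complex.ofReal_re, Real.norm_eq_abs, Real.norm_eq_abs,
      abs_of_nonneg (Real.sqrt_nonneg _),
      abs_of_nonneg (by positivity)]
    have h2 : (Real.sqrt Real.pi)⁻¹ ≤ 1 := by
      apply inv_le_one_of_one_le₀
      rw [Real.one_le_sqrt]; linarith [Real.pi_gt_three]
    have h3 : Real.sqrt a ≤ 1 := Real.sqrt_le_one.2 ha1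
    have h4 : Real.sqrt a * (Real.sqrt Real.pi)⁻¹ ≤ 1 := mul_le_one₀ h3 (by positivity) h2
    exact mul_le_of_le_one_left (Real.exp_pos _).le h4
  have hGa : ‖podGenFun a‖ ≤ (1 + C) * Real.exp x := by
    have h2 := norm_sub_norm_le (podGenFun a) (podMain a)
    have h3 : C * a * ‖podMain a‖ ≤ C * 1 * ‖podMain a‖ := by gcongr
    have h4 : C * ‖podMain a‖ ≤ C * Real.exp x := by gcongr
    linarith
  have hdec : Real.exp (-(1 / (400 * a))) ≤ 24 * 400 ^ 4 * (a ^ 3 * Real.sqrt a) := by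
    have h2 := Real.pow_div_factorial_le_exp (1 / (400 * a)) (by positivity) 4
    have h3 : Real.exp (-(1 / (400 * a))) ≤ 24 * 400 ^ 4 * a ^ 4 := by
      rw [Real.exp_neg, inv_le_comm₀ (Real.exp_pos _) (by positivity)]
      refine le_trans (le_of_eq ?_) h2
      norm_num [Nat.factorial]
      field_simp
      norm_num
    refine h3.trans ?_
    have h4 : a ≤ Real.sqrt a := Real.le_sqrt_of_sq_le (by nlinarith)
    calc 24 * 400 ^ 4 * a ^ 4 = 24 * 400 ^ 4 * (a ^ 3 * a) := by ring
      _ ≤ _ := by gcongr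
  have hre : (0 : ℝ) ≤ ((a : ℂ) + θ * Complex.I).re := by simpa using ha.le
  have hexp : ‖Complex.exp (n * (a + θ * Complex.I))‖ = Real.exp x := by
    rw [Complex.norm_exp, ← hn]; simp
  rw [cauchyIntegrand, norm_mul, norm_mul, hexp]
  calc _ ≤ ((1 + C) * Real.exp x * (24 * 400 ^ 4 * (a ^ 3 * Real.sqrt a))) * Real.exp x *
        (2 * k) := by
        gcongr
        · refine (norm_podGenFun_minor_le ha ha1 hθ hθ').trans ?_
          gcongr
        · exact norm_truncTheta_le hre k
    _ = _ := by
      rw [show 2 * x = x + x by ring, Real.exp_add]; ring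

/-- The asymptotic formula for `MP k n` in terms of the saddle point `a`; here
`2 x = π √(n / 2)`. -/
theorem exists_MP_approx : ∃ C : ℝ, 0 < C ∧ ∃ a₀ : ℝ, 0 < a₀ ∧
    ∀ (a x : ℝ) (n k : ℕ), 0 < a → a ≤ a₀ → n * a = x → Real.pi ^ 2 / 8 = x * a → 1 ≤ k →
      |2 * Real.pi * MP k n - k * a ^ 3 * (Real.sqrt 8 / Real.pi) * Real.exp (2 * x)| ≤
      C * (k * (a ^ 3 * Real.sqrt a) + k ^ 5 * a ^ 4) * Real.exp (2 * x) := by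
  obtain ⟨C, hC, a₀, h0, h1, hmaj⟩ := exists_integral_major
  obtain ⟨D, hD, b₀, hb0, hb1, hmin⟩ := exists_cauchyIntegrand_minor
  refine ⟨C + 8 * D, by positivity, min a₀ b₀, lt_min h0 hb0, ?_⟩
  intro a x n k ha hle hn hx hk
  have haa := hle.trans (min_le_left _ _)
  have hab := hle.trans (min_le_right _ _)
  have hpi := Real.pi_gt_three
  have hpi4 := Real.pi_le_four
  have hint := fun u v => (continuous_cauchyIntegrand k n ha).intervalIntegrable (μ := volume) u v
  have hcauchy := integral_podGenFun_mul_truncTheta ha k n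
  have hsplit : ∫ θ in -Real.pi..Real.pi, cauchyIntegrand k n a θ =
      (∫ θ in -Real.pi..-a, cauchyIntegrand k n a θ) + (∫ θ in -a..a, cauchyIntegrand k n a θ) +
      ∫ θ in a..Real.pi, cauchyIntegrand k n a θ := by
    rw [intervalIntegral.integral_add_adjacent_intervals (hint _ _) (hint _ _),
      intervalIntegral.integral_add_adjacent_intervals (hint _ _) (hint _ _)]
  set B := D * (k * (a ^ 3 * Real.sqrt a)) * Real.exp (2 * x) with hB
  have hB0 : 0 ≤ B := by positivity
  have hl : ‖∫ θ in -Real.pi..-a, cauchyIntegrand k n a θ‖ ≤ 4 * B := by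
    refine (intervalIntegral.norm_integral_le_of_norm_le_const (C := B) fun θ hθ => ?_).trans ?_
    · rw [Set.uIoc_of_le (by linarith)] at hθ
      have h2 : |θ| = -θ := abs_of_nonpos (by linarith [hθ.2])
      exact hmin a x n k ha hab hn hx θ (by rw [h2]; linarith [hθ.2]) (by rw [h2]; linarith [hθ.1])
    · rw [abs_of_nonneg (by linarith)]; nlinarith
  have hr : ‖∫ θ in a..Real.pi, cauchyIntegrand k n a θ‖ ≤ 4 * B := by
    refine (intervalIntegral.norm_integral_le_of_norm_le_const (C := B) fun θ hθ => ?_).trans ?_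
    · rw [Set.uIoc_of_le (by linarith)] at hθ
      have h2 : |θ| = θ := abs_of_pos (by linarith [hθ.1])
      exact hmin a x n k ha hab hn hx θ (by rw [h2]; linarith [hθ.1]) (by rw [h2]; linarith [hθ.2])
    · rw [abs_of_nonneg (by linarith)]; nlinarith
  have hm := hmaj a x n k ha haa hn hx hk
  have heq : ((2 * Real.pi * MP k n - k * a ^ 3 * (Real.sqrt 8 / Real.pi) * Real.exp (2 * x) : ℝ) :
      ℂ) = (∫ θ in -Real.pi..-a, cauchyIntegrand k n a θ) +
      ((∫ θ in -a..a, cauchyIntegrand k n a θ) -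
        ((k * a ^ 3 * (Real.sqrt 8 / Real.pi) * Real.exp (2 * x) : ℝ) : ℂ)) +
      ∫ θ in a..Real.pi, cauchyIntegrand k n a θ := by
    have h2 : ∫ θ in -Real.pi..Real.pi, cauchyIntegrand k n a θ = 2 * Real.pi * MP k n := hcauchy
    rw [hsplit] at h2
    rw [Complex.ofReal_sub]
    push_cast at h2 ⊢
    linear_combination -h2
  rw [← Real.norm_eq_abs, ← Complex.norm_real, heq]
  refine (norm_add₃_le).trans ?_
  have p2 : 0 ≤ D * (k ^ 5 * a ^ 4) * Real.exp (2 * x) := by positivity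
  have hBe : (C + 8 * D) * (k * (a ^ 3 * Real.sqrt a) + k ^ 5 * a ^ 4) * Real.exp (2 * x) =
    C * (k * (a ^ 3 * Real.sqrt a) + k ^ 5 * a ^ 4) * Real.exp (2 * x) + 8 * B +
      8 * (D * (k ^ 5 * a ^ 4) * Real.exp (2 * x)) := by rw [hB]; ring
  rw [hBe]
  linarith

/-! ### The asymptotic formula -/

/-- The saddle point `a = π / √(8n)` and its value, in terms of the fourth root `s` of `n`. -/
theorem saddle_numerics {s a : ℝ} (hs : 0 < s) (ha : a = Real.pi / (Real.sqrt 8 * s ^ 2)) :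
    s ^ 4 * a * a = Real.pi ^ 2 / 8 ∧ a ≤ 2 / s ^ 2 ∧ Real.sqrt a ≤ 2 / s ∧
      2 * (s ^ 4 * a) = Real.pi * s ^ 2 / Real.sqrt 2 ∧
      a ^ 3 * (Real.sqrt 8 / Real.pi) = 2 * Real.pi * (Real.pi / 16 * (s ^ 6)⁻¹) := by
  have hpi := Real.pi_pos
  have h8 : Real.sqrt 8 = 2 * Real.sqrt 2 := by
    rw [show (8 : ℝ) = 2 ^ 2 * 2 by norm_num, Real.sqrt_mul (by norm_num),
      Real.sqrt_sq (by norm_num)]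
  have h2 : Real.sqrt 2 ^ 2 = 2 := Real.sq_sqrt (by norm_num)
  have h2p : 0 < Real.sqrt 2 := by positivity
  have hale : a ≤ 2 / s ^ 2 := by
    rw [ha, ← div_div]
    gcongr
    rw [div_le_iff₀ (by positivity), h8]
    have : 1 ≤ Real.sqrt 2 := by rw [Real.one_le_sqrt]; norm_num
    linarith [Real.pi_le_four]
  refine ⟨?_, hale, ?_, ?_, ?_⟩
  · rw [ha, h8]
    field_simp
    rw [h2]; norm_num
  · refine Real.sqrt_le_iff.2 ⟨by positivity, hale.trans ?_⟩
    rw [div_pow]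
    gcongr
    norm_num
  · rw [ha, h8]
    field_simp
  · rw [ha, h8]
    field_simp
    rw [h2]; norm_num

theorem mainTheorem3 :
    ∃ C : ℝ, 0 < C ∧ ∀ ε : ℝ, 0 < ε → ∀ A : ℝ, 0 < A → ∃ N : ℕ, ∀ n : ℕ, N ≤ n →
      ∀ k : ℕ, 1 ≤ k → (k : ℝ) ≤ A * (n : ℝ) ^ ((1 : ℝ) / 8 - ε) →
        |(MP k n : ℝ) - Real.pi / 16 * (k : ℝ) * (n : ℝ) ^ (-(3 : ℝ) / 2) *
            Real.exp (Real.pi * Real.sqrt (n : ℝ) / Real.sqrt 2)|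
          ≤ C * ((k : ℝ) ^ 3 * (n : ℝ) ^ (-(7 : ℝ) / 4) *
            Real.exp (Real.pi * Real.sqrt (n : ℝ) / Real.sqrt 2)) := by
  obtain ⟨C, hC, a₀, ha₀, happ⟩ := exists_MP_approx
  refine ⟨32 * C, by positivity, fun ε hε A hA => ?_⟩
  have ev1 : ∀ᶠ n : ℕ in atTop, A ≤ (n : ℝ) ^ ε :=
    ((tendsto_rpow_atTop hε).comp tendsto_natCast_atTop_atTop).eventually_ge_atTop A
  have ev2 : ∀ᶠ n : ℕ in atTop, 2 / a₀ ≤ Real.sqrt n :=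
    (Real.tendsto_sqrt_atTop.comp tendsto_natCast_atTop_atTop).eventually_ge_atTop _
  obtain ⟨N, hN⟩ := eventually_atTop.1 (ev1.and (ev2.and (eventually_ge_atTop 1)))
  refine ⟨N, fun n hn k hk hkA => ?_⟩
  obtain ⟨hAn, hsn, hn1⟩ := hN n hn
  have hn0 : (0 : ℝ) < n := by exact_mod_cast hn1
  -- all powers of `n` are expressed through its fourth root
  set s : ℝ := (n : ℝ) ^ (1 / 4 : ℝ) with hs
  have hs0 : 0 < s := by positivity
  have hpow : ∀ j : ℕ, s ^ j = (n : ℝ) ^ ((j : ℝ) / 4) := by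
    intro j
    rw [hs, ← Real.rpow_mul_natCast hn0.le]
    congr 1; ring
  have hs4 : (n : ℝ) = s ^ 4 := by rw [hpow]; norm_num
  have hsq : Real.sqrt n = s ^ 2 := by rw [hpow, Real.sqrt_eq_rpow]; norm_num
  have h32 : (n : ℝ) ^ (-(3 : ℝ) / 2) = (s ^ 6)⁻¹ := by
    rw [hpow, ← Real.rpow_neg hn0.le]; norm_num
  have h74 : (n : ℝ) ^ (-(7 : ℝ) / 4) = (s ^ 7)⁻¹ := by
    rw [hpow, ← Real.rpow_neg hn0.le]; norm_num
  have hk1 : (1 : ℝ) ≤ k := by exact_mod_cast hk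
  have hk2 : (k : ℝ) ^ 2 ≤ s := by
    have h1 : (k : ℝ) ≤ (n : ℝ) ^ (1 / 8 : ℝ) := by
      refine hkA.trans ?_
      calc A * (n : ℝ) ^ ((1 : ℝ) / 8 - ε) ≤ (n : ℝ) ^ ε * (n : ℝ) ^ ((1 : ℝ) / 8 - ε) := by gcongr
        _ = (n : ℝ) ^ (1 / 8 : ℝ) := by rw [← Real.rpow_add hn0]; congr 1; ring
    calc (k : ℝ) ^ 2 ≤ ((n : ℝ) ^ (1 / 8 : ℝ)) ^ 2 := by gcongr
      _ = s := by rw [hs, ← Real.rpow_mul_natCast hn0.le]; norm_num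
  rw [h32, h74, hsq]
  rw [hsq, div_le_iff₀ ha₀] at hsn
  set a : ℝ := Real.pi / (Real.sqrt 8 * s ^ 2) with ha
  have hpi := Real.pi_gt_three
  have ha0 : 0 < a := by positivity
  obtain ⟨e1, e2, e3, e4, e5⟩ := saddle_numerics hs0 ha
  have haa : a ≤ a₀ := by
    refine e2.trans ?_
    rw [div_le_iff₀ (by positivity)]; linarith
  have h := happ a (s ^ 4 * a) n k ha0 haa (by rw [← hs4]) e1.symm hk
  rw [e4, mul_assoc (k : ℝ) (a ^ 3), e5] at h
  set E := Real.exp (Real.pi * s ^ 2 / Real.sqrt 2) with hE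
  have hE0 : 0 < E := Real.exp_pos _
  have b1 : (k : ℝ) * (a ^ 3 * Real.sqrt a) ≤ 16 * (k ^ 3 * (s ^ 7)⁻¹) := by
    calc (k : ℝ) * (a ^ 3 * Real.sqrt a) ≤ k ^ 3 * ((2 / s ^ 2) ^ 3 * (2 / s)) := by
          gcongr
          exact le_self_pow₀ hk1 (by norm_num)
      _ = _ := by field_simp; norm_num
  have b2 : (k : ℝ) ^ 5 * a ^ 4 ≤ 16 * (k ^ 3 * (s ^ 7)⁻¹) := by
    calc (k : ℝ) ^ 5 * a ^ 4 = k ^ 3 * k ^ 2 * a ^ 4 := by ring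
      _ ≤ k ^ 3 * s * (2 / s ^ 2) ^ 4 := by gcongr
      _ = _ := by field_simp; norm_num
  have h' : |2 * Real.pi * ((MP k n : ℝ) - Real.pi / 16 * k * (s ^ 6)⁻¹ * E)| ≤
      C * (32 * (k ^ 3 * (s ^ 7)⁻¹)) * E := by
    calc _ = |2 * Real.pi * MP k n - k * (2 * Real.pi * (Real.pi / 16 * (s ^ 6)⁻¹)) * E| := by
          congr 1; ring
      _ ≤ _ := h
      _ ≤ _ := by
        gcongr
        linarith
  rw [abs_mul, abs_of_pos (by positivity)] at h'
  have h1 : |(MP k n : ℝ) - Real.pi / 16 * k * (s ^ 6)⁻¹ * E| ≤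
      2 * Real.pi * |(MP k n : ℝ) - Real.pi / 16 * k * (s ^ 6)⁻¹ * E| :=
    le_mul_of_one_le_left (abs_nonneg _) (by linarith)
  calc _ ≤ C * (32 * (k ^ 3 * (s ^ 7)⁻¹)) * E := h1.trans h'
    _ = _ := by ring
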